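/- Let $n\ge 0$ be an integer and let $(M,\omega)$ be an $n$-plectic manifold: $M$ is a (Hausdorff, second countable, finite-dimensional) smooth manifold and $\omega$ is a closed $(n+1)$-form such that, for every $x\in M$ and $v\in T_xM$, $\iota_v\omega_x=0$ implies $v=0$. Put $\Omega^p(M)=0$ for $p<0$. Multivector fields of degree $k$ are the elements of $\mathfrak X^k(M)=\bigwedge^k_{C^\infty(M)}\mathfrak X(M)$, and $\iota_{X_1\wedge\dots\wedge X_k}=\iota_{X_k}\cdots\iota_{X_1}$. A form $\alpha$ of degree $n-k$ is Hamiltonian, $\alpha\in\Omega^{n-k}_{\mathrm{Ham}}(M)$, if there is $v_\alpha\in\mathfrak X^k(M)$ with $d\alpha=-\iota_{v_\alpha}\omega$; any such $v_\alpha$ is called a Hamiltonian multivector field of $\alpha$. Let $u$ be a formal variable with $du=0$ and define the bigraded real vector space $L=\bigoplus_{i,j}L_{i,j}$ by $$L_{0,j}=\Omega^{n-j-1}_{\mathrm{Ham}}(M)\,u^j,\qquad L_{i,j}=\Omega^{n-i-j-1}(M)\,u^j\quad(i\ge 1),\qquad j\ge 0,$$ and $L_{i,j}=0$ if $i<0$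 or $j<0$. For $x\in L_{i,j}$ let $|x|=i+j$ be its total degree. Then there are real multilinear maps $l_k:L^{\otimes k}\to L$ $(k\ge 1)$ of bidegree $(k-2,0)$ such that: * $l_1(\alpha u^j)=(d\alpha)u^j$ on $L_{i,j}$ for $i\ge1$, and $l_1=0$ on $L_{0,j}$; * for $k\ge2$ and $\alpha_t u^{j_t}\in L_{0,j_t}$ $(1\le t\le k)$, and for any choice of Hamiltonian multivector fields $v_{\alpha_t}\in\mathfrak X^{j_t+1}(M)$, $$l_k(\alpha_1u^{j_1},\dots,\alpha_ku^{j_k})=(-1)^{\sum_{t=1}^k(t-1)(j_t+1)}\;\iota_{v_{\alpha_1}\wedge\dots\wedge v_{\alpha_k}}\omega\;u^{j_1+\dots+j_k};$$ * for $k\ge 2$, $l_k(x_1,\dots,x_k)=0$ if some homogeneous $x_t$ has positive first degree; and $(L,\{l_k\})$ is a graded $L_\infty$-algebra. That is, with $(-1)^\sigma$ the sign of a permutation and $\epsilon(\sigma)$ its Koszul sign with respect to total degrees, each $l_k$ is graded skew-symmetric, $l_k(x_{\sigma(1)},\dots,x_{\sigma(k)})=(-1)^\sigma\epsilon(\sigma)\,l_k(x_1,\dots,x_k)$,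 and for all $m\ge1$ and homogeneous $x_1,\dots,x_m\in L$ $$\sum_{\substack{i+j=m+1\\ i,j\ge1}}\ \sum_{\sigma\in\mathrm{Sh}(i,m-i)}(-1)^\sigma\epsilon(\sigma)(-1)^{i(j-1)}\,l_j\bigl(l_i(x_{\sigma(1)},\dots,x_{\sigma(i)}),x_{\sigma(i+1)},\dots,x_{\sigma(m)}\bigr)=0,$$ where $\mathrm{Sh}(i,m-i)$ is the set of permutations of $\{1,\dots,m\}$ that are increasing on $\{1,\dots,i\}$ and on $\{i+1,\dots,m\}$. Moreover, the part $L_{\bullet,0}$ is, after the change of sign $\alpha\mapsto-\alpha$, Rogers' $L_\infty$-algebra of $(M,\omega)$: every $\alpha\in L_{0,0}=\Omega^{n-1}_{\mathrm{Ham}}(M)$ has a unique Hamiltonian vector field, and for $k\ge2$ and $\alpha_1,\dots,\alpha_k\in L_{0,0}$, if $X_t$ is the Hamiltonian vector field of $-\alpha_t$, then $-l_k(\alpha_1,\dots,\alpha_k)=\varsigma(k)\,\iota_{X_1\wedge\dots\wedge X_k}\omega$, where $\varsigma(k)=(-1)^{k/2+1}$ for even $k$ and $\varsigma(k)=(-1)^{(k-1)/2}$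 for odd $k$. -/

import Mathlib

open scoped Manifold ContDiff DirectSum

noncomputable section

namespace NPlectic

/-! ### Cartan calculus

`A` is a commutative real algebra; it is applied below to `A = C^∞(M)` for a (Hausdorff, second
countable, finite dimensional) smooth manifold `M`.  Then derivations of `A` are the smooth vector
fields on `M`, and alternating `A`-multilinear maps on vector fields with values in `A` are the
smooth differential forms on `M`. -/

section Calculus

variable (A : Type*) [CommRing A] [Algebra ℝ A]

/-- The `A`-module (and real Lie algebra) of vector fields: derivations of the function algebra. -/
abbrev VField : Type _ := Derivation ℝ A A

/-- Differential `p`-forms: `A`-multilinear alternating maps `𝔛 × ⋯ × 𝔛 → A` in `p` arguments. -/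
abbrev Form (p : ℕ) : Type _ := VField A [⋀^Fin p]→ₗ[A] A

/-- Mixed differential forms, i.e. families of forms, one of every degree. (On a manifold, forms
of degree larger than the dimension vanish, so this is the direct sum of all `Ω^p`.) -/
abbrev MixedForm : Type _ := (p : ℕ) → Form A p

/-- The graded commutative algebra of multivector fields, i.e. the exterior algebra of the
`A`-module of vector fields. Its product is the wedge product; `⋀[A]^k (VField A)` is the
submodule of multivector fields of degree `k`. -/
abbrev Multivector : Type _ := ExteriorAlgebra A (VField A)

variable {A}

/-- A form regarded as a real multilinear alternating map. -/
def Form.real {p : ℕ} (α : Form A p) : VField A [⋀^Fin p]→ₗ[ℝ] A :=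
  { α.toMultilinearMap.restrictScalars ℝ with
    map_eq_zero_of_eq' := α.map_eq_zero_of_eq' }

@[simp] lemma Form.real_apply {p : ℕ} (α : Form A p) (X : Fin p → VField A) :
    α.real X = α X := rfl

/-- The real alternating map `(X₀, …, X_p) ↦ ∑ i, (-1)^i X_i (α (X₀, …, X̂_i, …, X_p))`. -/
def derivPart {p : ℕ} (α : Form A p) : VField A [⋀^Fin (p + 1)]→ₗ[ℝ] A :=
  AlternatingMap.alternatizeUncurryFin
    { toFun := fun X => (X : A →ₗ[ℝ] A).compAlternatingMap α.real
      map_add' := fun X Y => by ext; simp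
      map_smul' := fun c X => by ext; simp }

/-- The real alternating map
`(X₀, …, X_{p+1}) ↦ ∑_{i < j} (-1)^(i+j-1) α ([X_i, X_j], X₀, …, X̂_i, …, X̂_j, …, X_{p+1})`. -/
def bracketPart {p : ℕ} (α : Form A (p + 1)) : VField A [⋀^Fin (p + 2)]→ₗ[ℝ] A :=
  AlternatingMap.alternatizeUncurryFin (AlternatingMap.alternatizeUncurryFinLM ∘ₗ
    ((LieModule.toEnd ℝ (VField A) (VField A) : VField A →ₗ[ℝ] VField A →ₗ[ℝ] VField A).compr₂
      ((1 / 2 : ℝ) • α.real.curryLeft)))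

lemma derivPart_apply {p : ℕ} (α : Form A p) (X : Fin (p + 1) → VField A) :
    derivPart α X = ∑ i : Fin (p + 1), (-1 : ℤ) ^ (i : ℕ) • X i (α (i.removeNth X)) := by
  simp [derivPart, AlternatingMap.alternatizeUncurryFin_apply]

lemma bracketPart_apply {p : ℕ} (α : Form A (p + 1)) (X : Fin (p + 2) → VField A) :
    bracketPart α X = ∑ i : Fin (p + 1), ∑ j ≥ i, (-1 : ℤ) ^ (i + j : ℕ) •
      α (Matrix.vecCons ⁅X i.castSucc, X j.succ⁆ (j.removeNth (i.castSucc.removeNth X))) := by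
  rw [bracketPart, AlternatingMap.alternatizeUncurryFin_alternatizeUncurryFinLM_comp_apply]
  refine Finset.sum_congr rfl fun i _ => Finset.sum_congr rfl fun j _ => ?_
  congr 1
  set Y := j.removeNth (i.castSucc.removeNth X)
  have h : α (Matrix.vecCons ⁅X j.succ, X i.castSucc⁆ Y)
      = - α (Matrix.vecCons ⁅X i.castSucc, X j.succ⁆ Y) := by
    rw [← lie_skew]
    exact congrArg (fun β : Form A p => β Y) (α.curryLeft.map_neg _)
  simp only [LinearMap.compr₂_apply, LinearMap.smul_apply, AlternatingMap.smul_apply,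
    AlternatingMap.curryLeft_apply_apply, Form.real_apply, LieHom.coe_toLinearMap,
    LieModule.toEnd_apply_apply, h]
  rw [smul_neg, sub_neg_eq_add, ← add_smul]
  norm_num

/-- The value of the exterior derivative on vector fields:
`dα (X₀, …, X_p) = ∑ i, (-1)^i X_i (α (X₀, …, X̂_i, …, X_p))
  + ∑_{i < j} (-1)^(i+j) α ([X_i, X_j], X₀, …, X̂_i, …, X̂_j, …, X_p)`.
The pair of indices `i ≤ j` in the second sum stands for the pair of positions `i < j + 1`, which
accounts for the minus sign. -/
def koszulFormula : {p : ℕ} → Form A p → (Fin (p + 1) → VField A) → A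
  | 0, α, X => ∑ i : Fin 1, (-1 : ℤ) ^ (i : ℕ) • X i (α (i.removeNth X))
  | p + 1, α, X => (∑ i : Fin (p + 2), (-1 : ℤ) ^ (i : ℕ) • X i (α (i.removeNth X))) -
      ∑ i : Fin (p + 1), ∑ j ≥ i, (-1 : ℤ) ^ (i + j : ℕ) •
        α (Matrix.vecCons ⁅X i.castSucc, X j.succ⁆ (j.removeNth (i.castSucc.removeNth X)))

lemma exists_koszulFormula_eq : {p : ℕ} → (α : Form A p) →
    ∃ β : VField A [⋀^Fin (p + 1)]→ₗ[ℝ] A, ∀ X, β X = koszulFormula α X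
  | 0, α => ⟨derivPart α, fun X => derivPart_apply α X⟩
  | p + 1, α => ⟨derivPart α - bracketPart α, fun X => by
      rw [AlternatingMap.sub_apply, derivPart_apply, bracketPart_apply]; rfl⟩

lemma removeNth_succ_cons {p : ℕ} {B : Type*} (i : Fin (p + 1)) (b : B) (Y : Fin (p + 1) → B) :
    i.succ.removeNth (Matrix.vecCons b Y) = Matrix.vecCons b (i.removeNth Y) := by
  funext t
  cases t using Fin.cases <;> simp [Fin.removeNth_apply]

lemma removeNth_zero_cons {p : ℕ} {B : Type*} (b : B) (Y : Fin p → B) :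
    (0 : Fin (p + 1)).removeNth (Matrix.vecCons b Y) = Y := by
  funext t
  simp [Fin.removeNth_apply]

lemma koszulFormula_cons_smul {p : ℕ} (α : Form A p) (f : A) (X : VField A)
    (Y : Fin p → VField A) :
    koszulFormula α (Matrix.vecCons (f • X) Y) = f * koszulFormula α (Matrix.vecCons X Y) := by
  cases p with
  | zero => simp [koszulFormula]
  | succ p =>
    have h1 : ∀ i : Fin (p + 1), Y i (α (Matrix.vecCons (f • X) (i.removeNth Y)))
        = f * Y i (α (Matrix.vecCons X (i.removeNth Y)))
          + Y i f * α (Matrix.vecCons X (i.removeNth Y)) := by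
      intro i
      rw [α.map_vecCons_smul, smul_eq_mul, Derivation.leibniz]
      simp [mul_comm]
    have h2 : ∀ j : Fin (p + 1), α (Matrix.vecCons ⁅f • X, Y j⁆ (j.removeNth Y))
        = f * α (Matrix.vecCons ⁅X, Y j⁆ (j.removeNth Y))
          - Y j f * α (Matrix.vecCons X (j.removeNth Y)) := by
      intro j
      have e : ⁅f • X, Y j⁆ = f • ⁅X, Y j⁆ + (-(Y j f)) • X := by
        ext g
        simp [Derivation.commutator_apply, mul_sub]
        ring
      rw [e, α.map_vecCons_add, α.map_vecCons_smul, α.map_vecCons_smul]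
      simp [sub_eq_add_neg]
    have h3 : ∀ (i : Fin p) (j : Fin (p + 1)) (Z : VField A), i.succ ≤ j →
        α (Matrix.vecCons Z (j.removeNth (i.succ.castSucc.removeNth (Matrix.vecCons (f • X) Y))))
        = f * α (Matrix.vecCons Z
            (j.removeNth (i.succ.castSucc.removeNth (Matrix.vecCons X Y)))) := by
      intro i j Z hij
      obtain ⟨q, rfl⟩ : ∃ q, p = q + 1 := ⟨p - 1, by have := i.2; omega⟩
      obtain ⟨j, rfl⟩ := Fin.exists_succ_eq.2 (Fin.ne_zero_of_lt (lt_of_lt_of_le i.succ_pos hij))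
      rw [← Fin.succ_castSucc, removeNth_succ_cons, removeNth_succ_cons, removeNth_succ_cons,
        removeNth_succ_cons]
      exact (α.curryLeft Z).map_vecCons_smul _ _ _
    have h6 : (Finset.Ici (0 : Fin (p + 1))) = Finset.univ := by
      ext j; simp
    have h5 : ∀ Z : VField A, koszulFormula α (Matrix.vecCons Z Y) =
        Z (α Y) - (∑ i : Fin (p + 1), (-1 : ℤ) ^ (i : ℕ) • Y i (α (Matrix.vecCons Z (i.removeNth Y)))) -
          ((∑ j : Fin (p + 1), (-1 : ℤ) ^ (j : ℕ) • α (Matrix.vecCons ⁅Z, Y j⁆ (j.removeNth Y))) +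
          ∑ i : Fin p, ∑ j ≥ i.succ, (-1 : ℤ) ^ ((i.succ : Fin (p + 1)) + j : ℕ) •
            α (Matrix.vecCons ⁅Y i.castSucc, Y j⁆
              (j.removeNth (i.succ.castSucc.removeNth (Matrix.vecCons Z Y))))) := by
      intro Z
      rw [koszulFormula, Fin.sum_univ_succ (n := p + 1),
        Fin.sum_univ_succ (n := p) (f := fun i => ∑ j ≥ i, _)]
      simp only [removeNth_succ_cons, removeNth_zero_cons, Matrix.cons_val_succ,
        Matrix.cons_val_zero, Fin.castSucc_zero, h6, Fin.val_zero, zero_add, pow_zero, one_smul,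
        ← Fin.succ_castSucc]
      simp only [Fin.val_succ, pow_succ, mul_neg, mul_one, neg_smul, Finset.sum_neg_distrib,
        sub_eq_add_neg]
    have h4 : ∀ i : Fin p, ∑ j ≥ i.succ, (-1 : ℤ) ^ ((i.succ : Fin (p + 1)) + j : ℕ) •
          α (Matrix.vecCons ⁅Y i.castSucc, Y j⁆
            (j.removeNth (i.succ.castSucc.removeNth (Matrix.vecCons (f • X) Y))))
        = f * ∑ j ≥ i.succ, (-1 : ℤ) ^ ((i.succ : Fin (p + 1)) + j : ℕ) •
          α (Matrix.vecCons ⁅Y i.castSucc, Y j⁆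
            (j.removeNth (i.succ.castSucc.removeNth (Matrix.vecCons X Y)))) := by
      intro i
      rw [Finset.mul_sum]
      refine Finset.sum_congr rfl fun j hj => ?_
      rw [h3 i j _ (by simpa using hj), mul_smul_comm]
    rw [h5, h5, Finset.sum_congr rfl fun i _ => h4 i]
    simp only [h1, h2, smul_add, smul_sub, Finset.sum_add_distrib, Finset.sum_sub_distrib,
      ← mul_smul_comm, ← Finset.mul_sum, Derivation.smul_apply, smul_eq_mul]
    ring

lemma koszulFormula_update_smul {p : ℕ} (α : Form A p) (X : Fin (p + 1) → VField A)
    (c : Fin (p + 1)) (f : A) (x : VField A) :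
    koszulFormula α (Function.update X c (f • x)) = f * koszulFormula α (Function.update X c x) := by
  obtain ⟨β, hβ⟩ := exists_koszulFormula_eq α
  have key : ∀ y : VField A, koszulFormula α (Function.update X c y)
      = Equiv.Perm.sign (Equiv.swap 0 c) •
        koszulFormula α (Matrix.vecCons y (fun t => X (Equiv.swap 0 c t.succ))) := by
    intro y
    have e : Matrix.vecCons y (fun t => X (Equiv.swap 0 c t.succ))
        = Function.update X c y ∘ Equiv.swap 0 c := by
      funext t
      cases t using Fin.cases with
      | zero => simp
      | succ t =>
        have : Equiv.swap 0 c t.succ ≠ c := by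
          intro h
          have := congrArg (Equiv.swap 0 c) h
          simp at this
        simp [this]
    rw [e, ← hβ, ← hβ, β.map_perm, smul_smul, Int.units_mul_self, one_smul]
  rw [key, key, koszulFormula_cons_smul, mul_smul_comm]

/-- The exterior derivative `d : Ω^p → Ω^(p+1)`. -/
def exteriorDeriv (p : ℕ) : Form A p →ₗ[ℝ] Form A (p + 1) where
  toFun α :=
    { toFun := koszulFormula α
      map_update_add' := fun {h} X c x y => by
        obtain ⟨β, hβ⟩ := exists_koszulFormula_eq α
        rw [Subsingleton.elim h (instDecidableEqFin _)]
        simp only [← hβ, AlternatingMap.map_update_add]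
      map_update_smul' := fun {h} X c f x => by
        rw [Subsingleton.elim h (instDecidableEqFin _)]
        exact koszulFormula_update_smul α X c f x
      map_eq_zero_of_eq' := fun X i j h hij => by
        obtain ⟨β, hβ⟩ := exists_koszulFormula_eq α
        rw [← hβ]
        exact β.map_eq_zero_of_eq X h hij }
  map_add' α β := by
    ext X
    cases p
    · simp [koszulFormula]
    · simp [koszulFormula, Finset.sum_add_distrib]; abel
  map_smul' c α := by
    ext X
    cases p <;> simp [koszulFormula, Finset.smul_sum, smul_sub]

variable (A) in
/-- The exterior derivative on mixed forms. -/
def d : MixedForm A →ₗ[ℝ] MixedForm A :=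
  LinearMap.pi fun
    | 0 => 0
    | p + 1 => exteriorDeriv p ∘ₗ LinearMap.proj p

/-- The interior product `ι_X` of a vector field with mixed forms:
`(ι_X α)(Y₁, …, Y_p) = α (X, Y₁, …, Y_p)`, and `ι_X f = 0` for functions `f`. -/
def contractField : VField A →ₗ[A] Module.End A (MixedForm A) where
  toFun X := LinearMap.pi fun p =>
    (AlternatingMap.curryLeftLinearMap (R := A) (M := VField A) (N := A) (n := p)).flip X ∘ₗ
      LinearMap.proj (p + 1)
  map_add' X Y := by
    ext α p : 2
    simp
  map_smul' f X := by
    ext α p : 2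
    simp

/-- The interior product of multivector fields with mixed forms, determined by linearity and
`ι_{X₁ ∧ ⋯ ∧ X_k} = ι_{X_k} ∘ ⋯ ∘ ι_{X₁}`: an algebra homomorphism from multivector fields with the
wedge product to the opposite of the algebra of endomorphisms. -/
def contractHom : Multivector A →ₐ[A] (Module.End A (MixedForm A))ᵐᵒᵖ :=
  ExteriorAlgebra.lift A
    ⟨(MulOpposite.opLinearEquiv A).toLinearMap ∘ₗ contractField, fun X => by
      apply MulOpposite.unop_injective
      ext α p : 2
      exact AlternatingMap.curryLeft_same (α (p + 1 + 1)) X⟩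

/-- The interior product `ι_v α` of a multivector field `v` with a mixed form `α`. -/
def contract (v : Multivector A) (α : MixedForm A) : MixedForm A :=
  (contractHom v).unop α

variable (A) in
/-- The real vector space of differential forms of degree `p`, inside the mixed forms. The degree
is an integer; the space is zero for `p < 0`. -/
def formsOfDegree (p : ℤ) : Submodule ℝ (MixedForm A) where
  carrier := {α | ∀ q : ℕ, (q : ℤ) ≠ p → α q = 0}
  add_mem' hα hβ q hq := by simp [hα q hq, hβ q hq]
  zero_mem' q hq := rfl
  smul_mem' c α hα q hq := by simp [hα q hq]

/-- An `(n+1)`-form as a mixed form. -/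
def ofForm {p : ℕ} (η : Form A p) : MixedForm A := Pi.single p η

/-- `v` is a Hamiltonian multivector field of degree `k` of the form `α`: `dα = -ι_v η`. -/
def IsHamiltonianFor (η : MixedForm A) (k : ℕ) (α : MixedForm A) (v : Multivector A) : Prop :=
  v ∈ ⋀[A]^k (VField A) ∧ d A α = -contract v η

lemma contract_add (v w : Multivector A) (α : MixedForm A) :
    contract (v + w) α = contract v α + contract w α := by
  simp [contract]

lemma contract_smul (f : A) (v : Multivector A) (α : MixedForm A) :
    contract (f • v) α = f • contract v α := by
  simp [contract]

/-- The space `Ω_Ham^{n-k}` of Hamiltonian forms of degree `n - k`: forms `α` of that degree for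
which there is a multivector field `v` of degree `k` with `dα = -ι_v η`. -/
def hamiltonianForms (n : ℕ) (η : Form A (n + 1)) (k : ℕ) : Submodule ℝ (MixedForm A) where
  carrier := {α | α ∈ formsOfDegree A ((n : ℤ) - k) ∧
    ∃ v, IsHamiltonianFor (ofForm η) k α v}
  add_mem' := by
    rintro α β ⟨hα, v, hv, hdv⟩ ⟨hβ, w, hw, hdw⟩
    refine ⟨add_mem hα hβ, v + w, add_mem hv hw, ?_⟩
    rw [map_add, hdv, hdw, contract_add, neg_add]
  zero_mem' := ⟨zero_mem _, 0, zero_mem _, by simp [contract]⟩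
  smul_mem' := by
    rintro c α ⟨hα, v, hv, hdv⟩
    refine ⟨Submodule.smul_mem _ c hα, algebraMap ℝ A c • v, Submodule.smul_mem _ _ hv, ?_⟩
    rw [map_smul, hdv, contract_smul, smul_neg]
    congr 1
    funext p
    ext X
    exact (algebraMap_smul A c _).symm

/-- The bigraded vector space `L_{i,j}` of observables, `(i, j) ∈ ℤ × ℤ`. An element of `L_{i,j}`
is a monomial `α u^j`; it is represented by its coefficient `α`, the exponent of the formal
variable `u` being the second index. Thus `L_{0,j}` consists of Hamiltonian forms of degree
`n - j - 1` (with Hamiltonian multivector fields of degree `j + 1`), `L_{i,j}` of all forms of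
degree `n - i - j - 1` if `i ≥ 1`, and `L_{i,j} = 0` if `i < 0` or `j < 0`. -/
def observables (n : ℕ) (η : Form A (n + 1)) (a : ℤ × ℤ) : Submodule ℝ (MixedForm A) :=
  if a.1 < 0 ∨ a.2 < 0 then ⊥
  else if a.1 = 0 then hamiltonianForms n η (a.2.toNat + 1)
  else formsOfDegree A ((n : ℤ) - a.1 - a.2 - 1)

end Calculus

/-! ### `n`-plectic manifolds -/

section Manifold

variable {m : ℕ} (M : Type*) [TopologicalSpace M] [ChartedSpace (EuclideanSpace ℝ (Fin m)) M]

/-- The algebra of smooth real functions on `M`. -/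
abbrev SmoothFun : Type _ := C^∞⟮𝓡 m, M; ℝ⟯

variable {M}

/-- An `(n+1)`-form `η` on `M` is `n`-plectic if it is closed and nondegenerate: if the tangent
vector `X_x` at a point `x` satisfies `ι_{X_x} η_x = 0`, then `X_x = 0`. (Every tangent vector at
`x` is the value at `x` of a vector field.) -/
structure IsNPlectic {n : ℕ} (η : Form (SmoothFun (m := m) M) (n + 1)) : Prop where
  closed : exteriorDeriv (n + 1) η = 0
  nondegenerate : ∀ (x : M) (X : VField (SmoothFun (m := m) M)),
    (∀ Y : Fin n → VField (SmoothFun (m := m) M), η (Matrix.vecCons X Y) x = 0) →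
      Derivation.evalAt x X = 0

end Manifold

/-! ### Graded `L∞`-algebras -/

section LInfinity

/-- The Koszul sign `ε(σ; x₁, …, x_k)` of a permutation of homogeneous elements of degrees
`deg t`, defined by `x₁ ∧ ⋯ ∧ x_k = ε(σ) x_{σ(1)} ∧ ⋯ ∧ x_{σ(k)}` in the free graded commutative
algebra: every inversion of `σ` contributes the sign of exchanging the two elements. -/
def koszulSign {k : ℕ} (deg : Fin k → ℤ) (σ : Equiv.Perm (Fin k)) : ℤˣ :=
  ∏ s : Fin k, ∏ t : Fin k,
    if s < t ∧ σ t < σ s then (deg (σ s) * deg (σ t)).negOnePow else 1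

/-- `(p, k - p)`-unshuffles: permutations that are increasing on the first `p` positions and on the
remaining ones. -/
def IsUnshuffle {k : ℕ} (p : ℕ) (σ : Equiv.Perm (Fin k)) : Prop :=
  ∀ s t : Fin k, s < t → ((t : ℕ) < p ∨ p ≤ (s : ℕ)) → σ s < σ t

instance {k : ℕ} (p : ℕ) : DecidablePred (IsUnshuffle (k := k) p) :=
  fun σ => by unfold IsUnshuffle; infer_instance

/-- The total degree of a bidegree. -/
def totalDegree (a : ℤ × ℤ) : ℤ := a.1 + a.2

/-- A graded `L∞`-algebra on a bigraded real vector space `L`: multilinear brackets `l_k`, `k ≥ 1`,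
of bidegree `(k - 2, 0)` on the total space `⨁ L_{i,j}` that are graded skew-symmetric and satisfy
the generalized Jacobi identities, both with signs formed from total degrees and stated on
homogeneous elements `x₁, …, x_m`. (The component `bracket 0` plays no role.)

In `jacobi`, the index `i : Fin m` stands for the arity `i + 1` of the inner bracket, and `m - i` is
the arity of the outer one. -/
structure GradedLInfinityAlgebra (L : ℤ × ℤ → Type*) [∀ a, AddCommGroup (L a)]
    [∀ a, Module ℝ (L a)] where
  bracket (k : ℕ) : MultilinearMap ℝ (fun _ : Fin k => ⨁ a, L a) (⨁ a, L a)
  bidegree (k : ℕ) (hk : 1 ≤ k) (a : Fin k → ℤ × ℤ) (x : ∀ t, L (a t)) :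
    bracket k (fun t => DirectSum.lof ℝ _ L (a t) (x t)) ∈
      LinearMap.range (DirectSum.lof ℝ _ L ((k : ℤ) - 2 + ∑ t, (a t).1, ∑ t, (a t).2))
  skew (k : ℕ) (hk : 1 ≤ k) (a : Fin k → ℤ × ℤ) (x : ∀ t, L (a t)) (σ : Equiv.Perm (Fin k)) :
    bracket k (fun t => DirectSum.lof ℝ _ L (a (σ t)) (x (σ t))) =
      (Equiv.Perm.sign σ * koszulSign (fun t => totalDegree (a t)) σ) •
        bracket k (fun t => DirectSum.lof ℝ _ L (a t) (x t))
  jacobi (m : ℕ) (hm : 1 ≤ m) (a : Fin m → ℤ × ℤ) (x : ∀ t, L (a t)) :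
    let y : Fin m → ⨁ a, L a := fun t => DirectSum.lof ℝ _ L (a t) (x t)
    ∑ i : Fin m, ∑ σ : Equiv.Perm (Fin m) with IsUnshuffle (i + 1) σ,
      (Equiv.Perm.sign σ * koszulSign (fun t => totalDegree (a t)) σ *
          (-1) ^ (((i : ℕ) + 1) * (m - i - 1))) •
        bracket (m - i) (fun t : Fin (m - i) =>
          if (t : ℕ) = 0 then
            bracket (i + 1) (fun s : Fin (i + 1) => y (σ ⟨s, by omega⟩))
          else y (σ ⟨i + t, by omega⟩)) = 0

end LInfinity

/-- The sign in Rogers' brackets of Hamiltonian `(n-1)`-forms. -/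
def rogersSign (k : ℕ) : ℝ :=
  if Even k then (-1) ^ (k / 2 + 1) else (-1) ^ ((k - 1) / 2)

end NPlectic

end

/-!
Let `η` be a closed `(n+1)`-form. Everything follows from the way `d` interacts with contractions.

For vector fields, Cartan's formula `L_X = d ι_X + ι_X d` gives `[L_X, ι_Z] = ι_{[X, Z]}`
(`lieDeriv_contractField`). This says that a double commutator of `d` with contractions is again a
contraction. By induction on degrees the same holds for multivector fields: `[[d, ι_v], ι_w]` is
the contraction by a multivector field, the Schouten bracket of `v` and `w` up to sign
(`exists_isCommutator_lieOp`). In other words, `d` is a second order differential operator over the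
graded commutative algebra of contractions. Hence, if all `ι_{v_t} η` are closed, then
`d ι_{v₁ ∧ ⋯ ∧ v_m} η` is a signed sum, over pairs of indices, of the contractions of
`d ι_{v_a ∧ v_b} η` by the product of the remaining `v_t` (`d_contract_prod`).

Let now `v_t` be Hamiltonian multivector fields of forms `α_t`, so that `ι_{v_t} η = -d α_t` is
closed. For two of them, `d ι_{v ∧ w} η` is the contraction of `η` by the Schouten bracket up to
sign, so `l₂ (α, β)` is again Hamiltonian. In the generalized Jacobi identity, all terms except
`l₁ l_m` and `l_{m-1} l₂` vanish for degree reasons, or because `d² = 0` and exact forms have the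
Hamiltonian multivector field `0`; for `m ≤ 2` nothing is left. For `m ≥ 3` the term `l₁ l_m` is
`± d ι_{v₁ ∧ ⋯ ∧ v_m} η`, and a term of `l_{m-1} l₂` is the contraction of `d ι_{v_a ∧ v_b} η` by
the other multivector fields. They cancel by the second order formula (`nestedBracket_add_eq_zero`).

The value of `l_k` does not depend on the choice of the `v_t` (`contract_prod_congr`). To have
multilinear maps on the whole space, the Hamiltonian multivector fields are chosen by a real linear
section, and the powers of `u` are carried along by multiplying polynomials with multivector
coefficients (`slot`, `observableBracket`).

Signs are `sgn e` for parities `e : ZMod 2`. The `L∞`-signs refer to the total degrees `j_t` of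
`α_t u^{j_t}`, while wedge products of the `v_t` are reordered with the degrees `j_t + 1`; the
factor `(-1)^(∑ (t - 1) (j_t + 1))` in the brackets mediates between the two (`koszulSign_shift`).
-/

noncomputable section

namespace NPlectic

/-! ### Cartan calculus -/

section CartanCalculus

variable {A : Type*} [CommRing A] [Algebra ℝ A]

instance (p : ℕ) : IsScalarTower ℝ A (Form A p) where
  smul_assoc c f α := by
    ext X
    exact smul_assoc c f (α X)

@[simp] lemma d_zero_apply (α : MixedForm A) : d A α 0 = 0 := rfl

lemma d_succ_apply (α : MixedForm A) (p : ℕ) : d A α (p + 1) = exteriorDeriv p (α p) := rfl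

lemma exteriorDeriv_apply {p : ℕ} (α : Form A p) (X : Fin (p + 1) → VField A) :
    exteriorDeriv p α X = koszulFormula α X := rfl

lemma contractField_apply (X : VField A) (α : MixedForm A) (p : ℕ) (Y : Fin p → VField A) :
    contractField X α p Y = α (p + 1) (Matrix.vecCons X Y) := rfl

/-- The Lie derivative along a vector field, defined by Cartan's formula `L_X = d ι_X + ι_X d`. -/
def lieDeriv (X : VField A) : MixedForm A →ₗ[ℝ] MixedForm A :=
  d A ∘ₗ (contractField X).restrictScalars ℝ + (contractField X).restrictScalars ℝ ∘ₗ d A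

lemma lieDeriv_apply (X : VField A) (α : MixedForm A) :
    lieDeriv X α = d A (contractField X α) + contractField X (d A α) := rfl

lemma map_vecCons_swap {p : ℕ} (α : Form A (p + 2)) (X Z : VField A) (W : Fin p → VField A) :
    α (Matrix.vecCons X (Matrix.vecCons Z W)) = - α (Matrix.vecCons Z (Matrix.vecCons X W)) := by
  rw [← α.map_swap _ (Fin.zero_ne_one (n := p))]
  congr 1
  funext t
  refine Fin.cases ?_ (fun t => ?_) t
  · simp
  · refine Fin.cases ?_ (fun t => ?_) t
    · simp
    · rw [Function.comp, Equiv.swap_apply_of_ne_of_ne] <;>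
        simp [Fin.ext_iff]

/-- Expansion of the Koszul formula with respect to its first argument. It amounts to Cartan's
formula `ι_Z d α = L_Z α - d ι_Z α`, see `lieDeriv_apply_succ`. -/
lemma koszulFormula_cons {p : ℕ} (α : Form A (p + 1)) (Z : VField A) (Y : Fin (p + 1) → VField A) :
    koszulFormula α (Matrix.vecCons Z Y) = Z (α Y) - koszulFormula (α.curryLeft Z) Y
      - ∑ j : Fin (p + 1), (-1 : ℤ) ^ (j : ℕ) • α (Matrix.vecCons ⁅Z, Y j⁆ (j.removeNth Y)) := by
  have h6 : (Finset.Ici (0 : Fin (p + 1))) = Finset.univ := by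
    ext j; simp
  -- Split off the terms that involve the position of `Z`.
  rw [koszulFormula, Fin.sum_univ_succ (n := p + 1),
    Fin.sum_univ_succ (n := p) (f := fun i => ∑ j ≥ i, _)]
  cases p with
  | zero =>
    simp [koszulFormula, removeNth_succ_cons]
    ring
  | succ p =>
    -- Brackets `⁅Y i, Y j⁆`: moving `Z` past the bracket into first position costs a sign.
    have h7 : ∀ i : Fin (p + 1), ∑ j ≥ i.succ, (-1 : ℤ) ^ ((i.succ : Fin (p + 2)) + j : ℕ) •
          α (Matrix.vecCons ⁅Matrix.vecCons Z Y i.succ.castSucc, Matrix.vecCons Z Y j.succ⁆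
            (j.removeNth (i.succ.castSucc.removeNth (Matrix.vecCons Z Y))))
        = -∑ j ≥ i, (-1 : ℤ) ^ (i + j : ℕ) • (α.curryLeft Z)
          (Matrix.vecCons ⁅Y i.castSucc, Y j.succ⁆ (j.removeNth (i.castSucc.removeNth Y))) := by
      intro i
      have e : Finset.Ici i.succ = (Finset.Ici i).map (Fin.succEmb (p + 1)) := by
        rw [Fin.map_succEmb_Ici]
      rw [e, Finset.sum_map, ← Finset.sum_neg_distrib]
      refine Finset.sum_congr rfl fun j _ => ?_
      rw [Fin.coe_succEmb, ← Fin.succ_castSucc, removeNth_succ_cons, removeNth_succ_cons,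
        Matrix.cons_val_succ, Matrix.cons_val_succ, map_vecCons_swap]
      simp only [Fin.val_succ, AlternatingMap.curryLeft_apply_apply]
      rw [smul_neg, pow_add, pow_add, pow_succ, pow_succ]
      simp [pow_add]
    rw [Finset.sum_congr rfl fun i _ => h7 i]
    simp only [removeNth_succ_cons, removeNth_zero_cons, Matrix.cons_val_succ,
      Matrix.cons_val_zero, Fin.castSucc_zero, h6, Fin.val_zero, zero_add, pow_zero, one_smul]
    rw [koszulFormula]
    simp only [Fin.val_succ, pow_succ, mul_neg, mul_one, neg_smul, Finset.sum_neg_distrib,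
      AlternatingMap.curryLeft_apply_apply]
    abel

lemma lieDeriv_apply_zero (X : VField A) (α : MixedForm A) (Y : Fin 0 → VField A) :
    lieDeriv X α 0 Y = X (α 0 Y) := by
  rw [lieDeriv_apply]
  simp only [Pi.add_apply, d_zero_apply,
    contractField_apply, d_succ_apply, exteriorDeriv_apply, koszulFormula, zero_add]
  simp [Subsingleton.elim _ Y]

/-- The usual formula for the Lie derivative: the double sums in the Koszul formulas of `d ι_X α`
and `ι_X d α` cancel. -/
lemma lieDeriv_apply_succ (X : VField A) (α : MixedForm A) (p : ℕ) (Y : Fin (p + 1) → VField A) :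
    lieDeriv X α (p + 1) Y = X (α (p + 1) Y)
      - ∑ j : Fin (p + 1), (-1 : ℤ) ^ (j : ℕ) •
          α (p + 1) (Matrix.vecCons ⁅X, Y j⁆ (j.removeNth Y)) := by
  rw [lieDeriv_apply]
  simp only [Pi.add_apply, AlternatingMap.add_apply, contractField_apply, d_succ_apply,
    exteriorDeriv_apply]
  rw [koszulFormula_cons]
  have : contractField X α p = (α (p + 1)).curryLeft X := rfl
  rw [this]
  ring

/-- The commutation relation `[L_X, ι_Z] = ι_{[X, Z]}`. -/
lemma lieDeriv_contractField (X Z : VField A) (α : MixedForm A) :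
    lieDeriv X (contractField Z α) = contractField Z (lieDeriv X α) + contractField ⁅X, Z⁆ α := by
  funext p
  ext Y
  simp only [Pi.add_apply, AlternatingMap.add_apply, contractField_apply]
  rw [lieDeriv_apply_succ, Fin.sum_univ_succ]
  cases p with
  | zero =>
    rw [lieDeriv_apply_zero]
    simp [contractField_apply, Subsingleton.elim _ Y]
  | succ p =>
    rw [lieDeriv_apply_succ]
    simp only [contractField_apply, removeNth_succ_cons, removeNth_zero_cons,
      Matrix.cons_val_zero, Matrix.cons_val_succ]
    have h := fun j : Fin (p + 1) =>
      map_vecCons_swap (α (p + 2)) ⁅X, Y j⁆ Z (j.removeNth Y)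
    simp only [h, Fin.val_zero, pow_zero, one_smul, Fin.val_succ, pow_succ, mul_neg, mul_one,
      neg_smul, smul_neg, neg_neg]
    ring

/-- A form of positive degree vanishes if all its contractions by vector fields do. Identities
between operators that commute with contractions up to known terms thus follow by induction on the
degree. -/
lemma mixedForm_eq_zero_of_contractField {p : ℕ} {β : MixedForm A}
    (h : ∀ X, contractField X β p = 0) : β (p + 1) = 0 := by
  ext Y
  have := congrArg (fun γ : Form A p => γ (Matrix.vecTail Y)) (h (Matrix.vecHead Y))
  simpa [contractField_apply] using this

lemma lieDeriv_lie (X Y : VField A) (α : MixedForm A) :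
    lieDeriv X (lieDeriv Y α) - lieDeriv Y (lieDeriv X α) = lieDeriv ⁅X, Y⁆ α := by
  funext p
  rw [← sub_eq_zero]
  induction p generalizing α with
  | zero =>
    ext Z
    simp [lieDeriv_apply_zero, Derivation.commutator_apply]
  | succ p ih =>
    refine mixedForm_eq_zero_of_contractField
      (β := lieDeriv X (lieDeriv Y α) - lieDeriv Y (lieDeriv X α) - lieDeriv ⁅X, Y⁆ α) fun Z => ?_
    have key : contractField Z
        (lieDeriv X (lieDeriv Y α) - lieDeriv Y (lieDeriv X α) - lieDeriv ⁅X, Y⁆ α)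
        = lieDeriv X (lieDeriv Y (contractField Z α)) - lieDeriv Y (lieDeriv X (contractField Z α))
          - lieDeriv ⁅X, Y⁆ (contractField Z α) := by
      simp only [lieDeriv_contractField, map_add, map_sub, lie_lie]
      simp only [LinearMap.sub_apply]
      abel
    rw [key]
    exact ih (contractField Z α)

lemma lieDeriv_d (X : VField A) (α : MixedForm A) :
    lieDeriv X (d A α) = d A (lieDeriv X α) := by
  funext p
  rw [← sub_eq_zero]
  induction p generalizing α with
  | zero =>
    ext Z
    simp [lieDeriv_apply_zero]
  | succ p ih =>
    refine mixedForm_eq_zero_of_contractField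
      (β := lieDeriv X (d A α) - d A (lieDeriv X α)) fun Y => ?_
    have h1 : ∀ (Z : VField A) (β : MixedForm A),
        contractField Z (d A β) = lieDeriv Z β - d A (contractField Z β) := fun Z β => by
      rw [lieDeriv_apply]; abel
    have h2 : ∀ β, contractField Y (lieDeriv X β)
        = lieDeriv X (contractField Y β) - contractField ⁅X, Y⁆ β := fun β => by
      rw [lieDeriv_contractField]; abel
    have key : contractField Y (lieDeriv X (d A α) - d A (lieDeriv X α))
        = -(lieDeriv X (d A (contractField Y α)) - d A (lieDeriv X (contractField Y α))) := by
      rw [map_sub, h2, h1, h1, h1, h2, map_sub, map_sub, ← lieDeriv_lie X Y α]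
      abel
    rw [key, Pi.neg_apply, neg_eq_zero]
    exact ih (contractField Y α)

lemma d_d (α : MixedForm A) : d A (d A α) = 0 := by
  funext p
  induction p generalizing α with
  | zero => simp
  | succ p ih =>
    refine mixedForm_eq_zero_of_contractField (β := d A (d A α)) fun X => ?_
    have key : contractField X (d A (d A α)) = d A (d A (contractField X α)) := by
      have h1 := lieDeriv_d X α
      rw [lieDeriv_apply, lieDeriv_apply, map_add, add_comm] at h1
      exact add_right_cancel h1
    rw [key]
    exact ih (contractField X α)

end CartanCalculus

/-! ### Contractions by multivector fields and the Schouten bracket -/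

section Signs

/-- The sign `(-1)^e` of a parity `e`. -/
def sgn (e : ZMod 2) : ℝ := if e = 0 then 1 else -1

@[simp] lemma sgn_zero : sgn 0 = 1 := by simp [sgn]

lemma sgn_add (e f : ZMod 2) : sgn (e + f) = sgn e * sgn f := by
  have h : ∀ e : ZMod 2, e = 0 ∨ e = 1 := by decide
  have h2 : (1 : ZMod 2) + 1 = 0 := by decide
  rcases h e with rfl | rfl <;> rcases h f with rfl | rfl <;> simp [sgn, h2]

lemma sgn_one : sgn 1 = -1 := by simp [sgn]

lemma sgn_mul_self (e : ZMod 2) : sgn e * sgn e = 1 := by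
  rw [← sgn_add, CharTwo.add_self_eq_zero, sgn_zero]

lemma sgn_natCast (k : ℕ) : sgn (k : ZMod 2) = (-1) ^ k := by
  induction k with
  | zero => simp
  | succ k ih => rw [Nat.cast_succ, sgn_add, ih, sgn_one, pow_succ]

end Signs

section Contraction

variable {A : Type*} [CommRing A] [Algebra ℝ A]

lemma contract_mul (v w : Multivector A) (α : MixedForm A) :
    contract (v * w) α = contract w (contract v α) := by
  simp [contract]

lemma contract_one (α : MixedForm A) : contract 1 α = α := by
  simp [contract]

lemma contract_zero_left (α : MixedForm A) : contract 0 α = 0 := by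
  simp [contract]

lemma contract_ι (X : VField A) (α : MixedForm A) :
    contract (ExteriorAlgebra.ι A X) α = contractField X α := by
  simp [contract, contractHom]

/-- Contraction with mixed forms as a real bilinear map. -/
def contractLin : Multivector A →ₗ[ℝ] MixedForm A →ₗ[ℝ] MixedForm A :=
  LinearMap.mk₂ ℝ contract contract_add
    (fun c v α => by
      rw [← algebraMap_smul A c v, contract_smul, algebraMap_smul])
    (fun v α β => by simp [contract])
    (fun c v α => by
      unfold contract
      rw [← algebraMap_smul A c α, map_smul, algebraMap_smul])

@[simp] lemma contractLin_apply (v : Multivector A) (α : MixedForm A) :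
    contractLin v α = contract v α := rfl

lemma contract_smul_left (c : ℝ) (v : Multivector A) (α : MixedForm A) :
    contract (c • v) α = c • contract v α := by
  simp only [← contractLin_apply, map_smul, LinearMap.smul_apply]

lemma contract_neg_left (v : Multivector A) (α : MixedForm A) :
    contract (-v) α = -contract v α := by
  simp only [← contractLin_apply, map_neg, LinearMap.neg_apply]

lemma contract_smul_right (c : ℝ) (v : Multivector A) (α : MixedForm A) :
    contract v (c • α) = c • contract v α := by
  simp only [← contractLin_apply, map_smul]

lemma contract_add_right (v : Multivector A) (α β : MixedForm A) :
    contract v (α + β) = contract v α + contract v β := by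
  simp only [← contractLin_apply, map_add]

lemma contract_zero_right (v : Multivector A) : contract v (0 : MixedForm A) = 0 := by
  simp only [← contractLin_apply, map_zero]

lemma contract_sum_right {ι : Type*} (s : Finset ι) (v : Multivector A) (α : ι → MixedForm A) :
    contract v (∑ i ∈ s, α i) = ∑ i ∈ s, contract v (α i) := by
  simp only [← contractLin_apply, map_sum]

lemma mul_mem_exteriorPower {p q : ℕ} {v w : Multivector A} (hv : v ∈ ⋀[A]^p (VField A))
    (hw : w ∈ ⋀[A]^q (VField A)) : v * w ∈ ⋀[A]^(p + q) (VField A) := by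
  rw [ExteriorAlgebra.exteriorPower, pow_add]
  exact Submodule.mul_mem_mul hv hw

lemma ι_mem_exteriorPower (X : VField A) : ExteriorAlgebra.ι A X ∈ ⋀[A]^1 (VField A) := by
  rw [ExteriorAlgebra.exteriorPower, pow_one]
  exact LinearMap.mem_range_self _ X

lemma exists_ι_of_mem_exteriorPower_one {v : Multivector A} (hv : v ∈ ⋀[A]^1 (VField A)) :
    ∃ X, v = ExteriorAlgebra.ι A X := by
  rw [ExteriorAlgebra.exteriorPower, pow_one] at hv
  obtain ⟨X, rfl⟩ := hv
  exact ⟨X, rfl⟩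

lemma real_smul_mem_exteriorPower {p : ℕ} (c : ℝ) {v : Multivector A}
    (hv : v ∈ ⋀[A]^p (VField A)) : c • v ∈ ⋀[A]^p (VField A) := by
  rw [← algebraMap_smul A c v]
  exact Submodule.smul_mem _ _ hv

/-- Induction on the degree of a multivector field, peeling off one vector field on the left. -/
@[elab_as_elim]
lemma exteriorPower_induction {P : ∀ (p : ℕ) (v : Multivector A), v ∈ ⋀[A]^p (VField A) → Prop}
    (zero : ∀ v (hv : v ∈ ⋀[A]^0 (VField A)), P 0 v hv)
    (add : ∀ p, ∀ v (hv : v ∈ ⋀[A]^(p + 1) (VField A)), ∀ w (hw : w ∈ ⋀[A]^(p + 1) (VField A)),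
      P (p + 1) v hv → P (p + 1) w hw → P (p + 1) (v + w) (add_mem hv hw))
    (mul : ∀ p X, ∀ v (hv : v ∈ ⋀[A]^p (VField A)), P p v hv →
      ∀ h, P (p + 1) (ExteriorAlgebra.ι A X * v) h)
    (p : ℕ) (v : Multivector A) (hv : v ∈ ⋀[A]^p (VField A)) : P p v hv := by
  induction p generalizing v with
  | zero => exact zero v hv
  | succ p ih =>
    have hv' := hv
    rw [ExteriorAlgebra.exteriorPower, pow_succ'] at hv'
    suffices h : ∃ h : v ∈ ⋀[A]^(p + 1) (VField A), P (p + 1) v h from h.2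
    refine Submodule.mul_induction_on hv' ?_ ?_
    · rintro _ ⟨X, rfl⟩ w hw
      refine ⟨?_, mul p X w hw (ih w hw) _⟩
      rw [add_comm p 1]
      exact mul_mem_exteriorPower (ι_mem_exteriorPower X) hw
    · rintro a b ⟨ha, ha'⟩ ⟨hb, hb'⟩
      exact ⟨add_mem ha hb, add p a ha b hb ha' hb'⟩

/-- A vector field commutes with a multivector field of degree `q` up to `(-1)^q`. -/
lemma ι_mul_comm (X : VField A) (q : ℕ) (w : Multivector A) (hw : w ∈ ⋀[A]^q (VField A)) :
    ExteriorAlgebra.ι A X * w = sgn q • (w * ExteriorAlgebra.ι A X) := by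
  induction q, w, hw using exteriorPower_induction with
  | zero v hv =>
    rw [ExteriorAlgebra.exteriorPower, pow_zero, Submodule.mem_one] at hv
    obtain ⟨f, rfl⟩ := hv
    simp [Algebra.commutes]
  | add p v hv w hw ihv ihw => rw [mul_add, add_mul, ihv, ihw, smul_add]
  | mul p Y v hv ih _ =>
    have h : ExteriorAlgebra.ι A X * ExteriorAlgebra.ι A Y
        = -(ExteriorAlgebra.ι A Y * ExteriorAlgebra.ι A X) :=
      eq_neg_of_add_eq_zero_left (ExteriorAlgebra.ι_add_mul_swap X Y)
    rw [← mul_assoc, h, neg_mul, mul_assoc, ih, mul_smul_comm, mul_assoc, Nat.cast_succ, sgn_add,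
      sgn_one, mul_neg_one, neg_smul]

/-- The exterior algebra is graded commutative. -/
lemma mul_comm_of_mem_exteriorPower {p q : ℕ} {v w : Multivector A}
    (hv : v ∈ ⋀[A]^p (VField A)) (hw : w ∈ ⋀[A]^q (VField A)) :
    v * w = sgn (p * q) • (w * v) := by
  induction p, v, hv using exteriorPower_induction with
  | zero v hv =>
    rw [ExteriorAlgebra.exteriorPower, pow_zero, Submodule.mem_one] at hv
    obtain ⟨f, rfl⟩ := hv
    simp [Algebra.commutes]
  | add p v hv v' hv' ih ih' => rw [mul_add, add_mul, ih, ih', smul_add]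
  | mul p Y v hv ih _ =>
    rw [mul_assoc, ih, mul_smul_comm, ← mul_assoc, ι_mul_comm Y q w hw, smul_mul_assoc, smul_smul,
      ← sgn_add, mul_assoc]
    congr 2
    push_cast
    ring

end Contraction

section Schouten

variable {A : Type*} [CommRing A] [Algebra ℝ A]

/-- The graded commutator of an operator `D` of parity `r` with the contraction by `w`, of parity
`q`, is the contraction by `c`. -/
def IsCommutator (D : Module.End ℝ (MixedForm A)) (r : ZMod 2) (w : Multivector A) (q : ZMod 2)
    (c : Multivector A) : Prop :=
  ∀ α, D (contract w α) = contract c α + sgn (r * q) • contract w (D α)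

/-- If the graded commutators of `D` with contractions by vector fields are contractions by
multivector fields of degree `s`, then `[D, ι_w]` is a contraction for every `w`. -/
lemma exists_isCommutator {D : Module.End ℝ (MixedForm A)} {r : ZMod 2} {s : ℕ}
    (h : ∀ X, ∃ c ∈ ⋀[A]^s (VField A), IsCommutator D r (ExteriorAlgebra.ι A X) 1 c)
    (q : ℕ) (w : Multivector A) (hw : w ∈ ⋀[A]^(q + 1) (VField A)) :
    ∃ c ∈ ⋀[A]^(s + q) (VField A), IsCommutator D r w (q + 1 : ℕ) c := by
  have main : ∀ q w, w ∈ ⋀[A]^q (VField A) → 1 ≤ q →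
      ∃ c ∈ ⋀[A]^(s + q - 1) (VField A), IsCommutator D r w q c := by
    intro q w hw
    induction q, w, hw using exteriorPower_induction with
    | zero v hv => intro h; omega
    | add p v hv w hw ihv ihw =>
      intro hp
      obtain ⟨c, hc, hc'⟩ := ihv hp
      obtain ⟨e, he, he'⟩ := ihw hp
      refine ⟨c + e, add_mem hc he, fun α => ?_⟩
      rw [contract_add, map_add, hc', he', contract_add, contract_add, smul_add]
      abel
    | mul p X v hv ih _ =>
      intro _
      obtain ⟨c, hc, hc'⟩ := h X
      rcases Nat.eq_zero_or_pos p with rfl | hp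
      · -- `X ∧ f = f X` is again a vector field. The hypothesis says nothing
        -- about commutators of `D` with multiplication by the function `f`.
        rw [ExteriorAlgebra.exteriorPower, pow_zero, Submodule.mem_one] at hv
        obtain ⟨f, rfl⟩ := hv
        obtain ⟨c', hc, hc'⟩ := h (f • X)
        refine ⟨c', by simpa using hc, ?_⟩
        rw [← Algebra.commutes, ← Algebra.smul_def, ← map_smul]
        simpa using hc'
      · obtain ⟨c', h1, h2⟩ := ih hp
        refine ⟨ExteriorAlgebra.ι A X * c' + sgn (r * p) • (c * v), add_mem ?_
          (real_smul_mem_exteriorPower _ ?_), fun α => ?_⟩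
        · have := mul_mem_exteriorPower (ι_mem_exteriorPower X) h1
          rwa [show 1 + (s + p - 1) = s + (p + 1) - 1 by omega] at this
        · have := mul_mem_exteriorPower hc hv
          rwa [show s + p = s + (p + 1) - 1 by omega] at this
        · rw [contract_mul, h2, hc', contract_add, contract_smul_left, contract_mul, contract_mul,
            contract_mul, contract_add_right, contract_smul_right, smul_add, smul_smul, ← sgn_add]
          push_cast
          rw [mul_add, add_assoc]
  have := main (q + 1) w hw (by omega)
  rwa [← add_assoc, Nat.add_sub_cancel] at this

/-- The graded commutator of the exterior derivative with a contraction by `v`, of parity `p`. -/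
def lieOp (p : ZMod 2) (v : Multivector A) : Module.End ℝ (MixedForm A) :=
  d A ∘ₗ contractLin v - sgn p • (contractLin v ∘ₗ d A)

lemma lieOp_apply (p : ZMod 2) (v : Multivector A) (α : MixedForm A) :
    lieOp p v α = d A (contract v α) - sgn p • contract v (d A α) := rfl

/-- Existence of the Schouten bracket: the double commutator `[[d, ι_v], ι_w]` is the contraction
by a multivector field. -/
lemma exists_isCommutator_lieOp {p q : ℕ} {v w : Multivector A}
    (hv : v ∈ ⋀[A]^(p + 1) (VField A)) (hw : w ∈ ⋀[A]^(q + 1) (VField A)) :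
    ∃ c ∈ ⋀[A]^(p + q + 1) (VField A),
      IsCommutator (lieOp (p + 1 : ℕ) v) (p + 2 : ℕ) w (q + 1 : ℕ) c := by
  -- `[[d, ι_v], ι_X]` agrees up to sign with `[[d, ι_X], ι_v] = [L_X, ι_v]`, as contractions
  -- commute with each other and the Jacobi identity for graded commutators applies.
  have key : ∀ X : VField A, ∃ c ∈ ⋀[A]^(p + 1) (VField A),
      IsCommutator (lieOp (p + 1 : ℕ) v) (p + 2 : ℕ) (ExteriorAlgebra.ι A X) 1 c := by
    intro X
    have h1 : ∀ Y, ∃ c ∈ ⋀[A]^1 (VField A),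
        IsCommutator (lieDeriv X) 0 (ExteriorAlgebra.ι A Y) 1 c := fun Y =>
      ⟨ExteriorAlgebra.ι A ⁅X, Y⁆, ι_mem_exteriorPower _, fun α => by
        simp only [contract_ι, zero_mul, sgn_zero, one_smul]
        rw [lieDeriv_contractField, add_comm]⟩
    obtain ⟨c, hc, hc'⟩ := exists_isCommutator h1 p v hv
    refine ⟨sgn (p + 1 : ℕ) • c, real_smul_mem_exteriorPower _ (by rwa [add_comm p 1]), fun α => ?_⟩
    have h2 := hc' α
    have h3 : ∀ β, contractField X (contract v β)
        = sgn (p + 1 : ℕ) • contract v (contractField X β) := fun β => by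
      rw [← contract_ι, ← contract_ι, ← contract_mul, ← contract_mul, ι_mul_comm X _ v hv,
        contract_smul_left, smul_smul, sgn_mul_self, one_smul]
    have h4 : sgn ((p + 2 : ℕ) * 1) = - sgn (p + 1 : ℕ) := by
      rw [mul_one, ← mul_neg_one, ← sgn_one, ← sgn_add]
      push_cast
      ring_nf
    rw [lieDeriv_apply, lieDeriv_apply, zero_mul, sgn_zero, one_smul, h3, map_smul,
      contract_add_right] at h2
    rw [lieOp_apply, lieOp_apply, contract_smul_left, eq_sub_of_add_eq h2.symm, contract_ι,
      contract_ι, h4, map_sub, ← contract_ι X (sgn _ • _), contract_smul_right, contract_ι, h3]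
    simp only [smul_sub, smul_add, smul_smul, sgn_mul_self, one_smul, neg_smul]
    abel
  have := exists_isCommutator key q w hw
  rwa [show p + 1 + q = p + q + 1 by omega] at this

end Schouten

/-! ### Permutations, Koszul signs and wedge products -/

section Permutations

/-- The permutation `σ` of `{0, …, m}` with `σ 0 = i` for which `σ 1, …, σ m` enumerates the
complement of `i` in the order given by `τ`. -/
def insertPerm {m : ℕ} (i : Fin (m + 1)) (τ : Equiv.Perm (Fin m)) : Equiv.Perm (Fin (m + 1)) :=
  i.cycleRange.symm * Equiv.Perm.decomposeFin.symm (0, τ)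

@[simp] lemma insertPerm_zero {m : ℕ} (i : Fin (m + 1)) (τ : Equiv.Perm (Fin m)) :
    insertPerm i τ 0 = i := by
  simp [insertPerm]

@[simp] lemma insertPerm_succ {m : ℕ} (i : Fin (m + 1)) (τ : Equiv.Perm (Fin m)) (t : Fin m) :
    insertPerm i τ t.succ = i.succAbove (τ t) := by
  simp [insertPerm]

lemma insertPerm_bijective (m : ℕ) :
    Function.Bijective fun x : Fin (m + 1) × Equiv.Perm (Fin m) => insertPerm x.1 x.2 := by
  constructor
  · rintro ⟨i, τ⟩ ⟨j, ρ⟩ h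
    have h0 := congrArg (fun σ : Equiv.Perm (Fin (m + 1)) => σ 0) h
    simp only [insertPerm_zero] at h0
    subst h0
    refine Prod.ext rfl (Equiv.ext fun t => ?_)
    have h1 := congrArg (fun σ : Equiv.Perm (Fin (m + 1)) => σ t.succ) h
    simpa using h1
  · intro σ
    obtain ⟨⟨p, τ⟩, hτ⟩ := Equiv.Perm.decomposeFin.symm.surjective ((σ 0).cycleRange * σ)
    have hp : p = 0 := by
      have := congrArg (fun σ : Equiv.Perm (Fin (m + 1)) => σ 0) hτ
      simpa using this
    subst hp
    refine ⟨(σ 0, τ), ?_⟩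
    change (σ 0).cycleRange.symm * _ = σ
    rw [hτ]
    ext t
    simp

lemma exists_insertPerm {m : ℕ} (σ : Equiv.Perm (Fin (m + 1))) :
    ∃ i τ, σ = insertPerm i τ := by
  obtain ⟨⟨i, τ⟩, h⟩ := (insertPerm_bijective m).2 σ
  exact ⟨i, τ, h.symm⟩

lemma sum_perm_succ {m : ℕ} {B : Type*} [AddCommMonoid B] (F : Equiv.Perm (Fin (m + 1)) → B) :
    ∑ σ, F σ = ∑ i, ∑ τ, F (insertPerm i τ) := by
  rw [← (Equiv.ofBijective _ (insertPerm_bijective m)).sum_comp, Fintype.sum_prod_type]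
  rfl

lemma sign_insertPerm {m : ℕ} (i : Fin (m + 1)) (τ : Equiv.Perm (Fin m)) :
    (((Equiv.Perm.sign (insertPerm i τ) : ℤˣ) : ℤ) : ℝ)
      = sgn (i : ℕ) * ((Equiv.Perm.sign τ : ℤˣ) : ℤ) := by
  rw [insertPerm, Equiv.Perm.sign_mul, Equiv.Perm.sign_symm, Fin.sign_cycleRange,
    Equiv.Perm.decomposeFin.symm_sign, if_pos rfl, one_mul, sgn_natCast]
  push_cast
  rfl

/-- The sum of `p` over the indices below `i`, written as a sum over the complement of `i`. -/
def sumBelow {m : ℕ} (p : Fin (m + 1) → ZMod 2) (i : Fin (m + 1)) : ZMod 2 :=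
  ∑ t : Fin m, if t.castSucc < i then p (i.succAbove t) else 0

@[simp] lemma sumBelow_zero {m : ℕ} (p : Fin (m + 1) → ZMod 2) : sumBelow p 0 = 0 := by
  simp [sumBelow]

lemma sumBelow_succ {m : ℕ} (p : Fin (m + 2) → ZMod 2) (i : Fin (m + 1)) :
    sumBelow p i.succ = p 0 + sumBelow (fun t => p t.succ) i := by
  rw [sumBelow, Fin.sum_univ_succ, sumBelow]
  simp

/-- The parity of the Koszul sign of a permutation. -/
def koszulParity {m : ℕ} (p : Fin m → ZMod 2) (σ : Equiv.Perm (Fin m)) : ZMod 2 :=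
  ∑ s, ∑ t, if s < t ∧ σ t < σ s then p (σ s) * p (σ t) else 0

lemma sgn_intCast (e : ℤ) : sgn (e : ZMod 2) = ((e.negOnePow : ℤˣ) : ℤ) := by
  rcases Int.even_or_odd e with h | h
  · have : (e : ZMod 2) = 0 := (ZMod.intCast_zmod_eq_zero_iff_dvd e 2).2 h.two_dvd
    rw [Int.negOnePow_even e h, this]
    simp
  · have : (e : ZMod 2) = 1 := by
      obtain ⟨c, rfl⟩ := h
      push_cast
      rw [show (2 : ZMod 2) = 0 from rfl, zero_mul, zero_add]
    rw [Int.negOnePow_odd e h, this, sgn_one]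
    simp

lemma sgn_sum {ι : Type*} (s : Finset ι) (f : ι → ZMod 2) :
    sgn (∑ i ∈ s, f i) = ∏ i ∈ s, sgn (f i) := by
  classical
  induction s using Finset.induction_on with
  | empty => simp
  | insert a s ha ih => rw [Finset.sum_insert ha, Finset.prod_insert ha, sgn_add, ih]

lemma koszulSign_eq_sgn {m : ℕ} (deg : Fin m → ℤ) (σ : Equiv.Perm (Fin m)) :
    (((koszulSign deg σ : ℤˣ) : ℤ) : ℝ) = sgn (koszulParity (fun t => (deg t : ZMod 2)) σ) := by
  simp only [koszulSign, koszulParity, sgn_sum, Units.coe_prod, Int.cast_prod]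
  refine Finset.prod_congr rfl fun s _ => Finset.prod_congr rfl fun t _ => ?_
  split_ifs
  · rw [← sgn_intCast]
    push_cast
    rfl
  · simp

/-- Moving `i` to the front passes it over the smaller indices; the remaining inversions are those
of `τ`. -/
lemma koszulParity_insertPerm {m : ℕ} (p : Fin (m + 1) → ZMod 2) (i : Fin (m + 1))
    (τ : Equiv.Perm (Fin m)) :
    koszulParity p (insertPerm i τ)
      = p i * sumBelow p i + koszulParity (fun t => p (i.succAbove t)) τ := by
  rw [koszulParity, Fin.sum_univ_succ, Fin.sum_univ_succ]
  simp only [insertPerm_zero, insertPerm_succ, lt_self_iff_false, false_and, if_false, zero_add,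
    Fin.succ_pos, true_and, Fin.sum_univ_succ, not_lt_zero, Fin.succ_lt_succ_iff,
    Fin.succAbove_lt_succAbove_iff]
  rw [Equiv.sum_comp τ fun t => if i.succAbove t < i then p i * p (i.succAbove t) else 0]
  simp only [koszulParity, sumBelow, Finset.mul_sum, mul_ite, mul_zero,
    Fin.succAbove_lt_iff_castSucc_lt]

@[simp] lemma koszulParity_one {m : ℕ} (p : Fin m → ZMod 2) : koszulParity p 1 = 0 := by
  refine Finset.sum_eq_zero fun s _ => Finset.sum_eq_zero fun t _ => if_neg ?_
  rintro ⟨h1, h2⟩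
  exact lt_asymm h1 h2

/-- Modulo two, the weights `t` of the indices above `i` are shifted when `i` is removed. The
correction is the sum over the indices above `i`, written as the sum over all indices other than
`i` plus the sum over those below `i`. -/
lemma sum_mul_succAbove {m : ℕ} (p : Fin (m + 1) → ZMod 2) (i : Fin (m + 1)) :
    ∑ t : Fin (m + 1), ((t : ℕ) : ZMod 2) * p t
      = (i : ℕ) * p i + ∑ t : Fin m, ((t : ℕ) : ZMod 2) * p (i.succAbove t)
        + ∑ t : Fin m, p (i.succAbove t) + sumBelow p i := by
  rw [Fin.sum_univ_succAbove _ i, sumBelow, add_assoc, add_assoc, ← Finset.sum_add_distrib,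
    ← Finset.sum_add_distrib]
  congr 1
  refine Finset.sum_congr rfl fun t _ => ?_
  split_ifs with h
  · rw [Fin.succAbove_of_castSucc_lt _ _ h, Fin.val_castSucc]
    grind
  · rw [Fin.succAbove_of_le_castSucc _ _ (not_lt.1 h), Fin.val_succ]
    push_cast
    ring

lemma sumBelow_add_one {m : ℕ} (p : Fin (m + 1) → ZMod 2) (i : Fin (m + 1)) :
    sumBelow (fun t => p t + 1) i = sumBelow p i + (i : ℕ) := by
  induction m with
  | zero =>
    obtain rfl : i = 0 := Fin.eq_zero i
    simp
  | succ m ih =>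
    refine Fin.cases (by simp) (fun i => ?_) i
    rw [sumBelow_succ, sumBelow_succ, ih (fun t => p t.succ) i]
    simp
    ring

/-- Compatibility of the Koszul signs for a grading and for the grading shifted by one: they differ
by the sign of the permutation and the change of `(-1) ^ ∑ t * p t`. -/
lemma koszulSign_shift {m : ℕ} (j : Fin m → ZMod 2) (σ : Equiv.Perm (Fin m)) :
    ((Equiv.Perm.sign σ : ℤˣ) : ℤ) * sgn (koszulParity j σ)
      = sgn (∑ t : Fin m, ((t : ℕ) : ZMod 2) * (j (σ t) + 1)
          + ∑ t : Fin m, ((t : ℕ) : ZMod 2) * (j t + 1)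
          + koszulParity (fun t => j t + 1) σ) := by
  induction m with
  | zero => simp [koszulParity, Subsingleton.elim σ 1]
  | succ m ih =>
    obtain ⟨i, τ, rfl⟩ := exists_insertPerm σ
    have h := ih (fun t => j (i.succAbove t)) τ
    rw [sign_insertPerm, koszulParity_insertPerm, koszulParity_insertPerm, sgn_add,
      mul_mul_mul_comm, h, ← sgn_add, ← sgn_add, sum_mul_succAbove (fun t => j t + 1) i,
      sumBelow_add_one, Fin.sum_univ_succ
        (f := fun t => ((t : ℕ) : ZMod 2) * (j (insertPerm i τ t) + 1))]
    simp only [insertPerm_succ, Fin.val_succ, Nat.cast_succ, add_mul, one_mul,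
      Finset.sum_add_distrib (s := (Finset.univ : Finset (Fin m)))]
    simp only [Fin.val_zero, Nat.cast_zero, zero_mul]
    rw [Equiv.sum_comp τ fun t => j (i.succAbove t)]
    congr 1
    grind

lemma isUnshuffle_zero {m : ℕ} {τ : Equiv.Perm (Fin m)} : IsUnshuffle 0 τ ↔ τ = 1 := by
  constructor
  · intro h
    have h1 : StrictMono τ := fun s t hst => h s t hst (Or.inr (Nat.zero_le _))
    exact Equiv.ext fun t => congrFun ((h1.range_inj strictMono_id).1 (by simp)) t
  · rintro rfl s t h _
    exact h

/-- The only `(m, 0)`-unshuffle is the identity. -/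
lemma isUnshuffle_self {m : ℕ} {τ : Equiv.Perm (Fin m)} : IsUnshuffle m τ ↔ τ = 1 := by
  constructor
  · intro h
    have h1 : StrictMono τ := fun s t hst => h s t hst (Or.inl t.2)
    exact Equiv.ext fun t => congrFun ((h1.range_inj strictMono_id).1 (by simp)) t
  · rintro rfl s t h _
    exact h

lemma isUnshuffle_insertPerm {m p : ℕ} {i : Fin (m + 1)} {τ : Equiv.Perm (Fin m)} :
    IsUnshuffle (p + 1) (insertPerm i τ) ↔
      (∀ t : Fin m, (t : ℕ) < p → i < i.succAbove (τ t)) ∧ IsUnshuffle p τ := by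
  unfold IsUnshuffle
  rw [Fin.forall_fin_succ]
  simp [Fin.forall_fin_succ]

/-- `(2, m)`-unshuffles are given by the pair of positions `i < i.succAbove j` they move to the
front. -/
lemma sum_isUnshuffle_two {m : ℕ} {B : Type*} [AddCommMonoid B]
    (F : Equiv.Perm (Fin (m + 2)) → B) :
    ∑ σ : Equiv.Perm (Fin (m + 2)) with IsUnshuffle 2 σ, F σ
      = ∑ i : Fin (m + 2), ∑ j : Fin (m + 1),
          if i ≤ j.castSucc then F (insertPerm i (insertPerm j 1)) else 0 := by
  rw [Finset.sum_filter, sum_perm_succ]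
  refine Finset.sum_congr rfl fun i _ => ?_
  rw [sum_perm_succ]
  refine Finset.sum_congr rfl fun j _ => ?_
  have h : ∀ τ : Equiv.Perm (Fin m), IsUnshuffle 2 (insertPerm i (insertPerm j τ)) ↔
      (i ≤ j.castSucc ∧ τ = 1) := by
    intro τ
    rw [isUnshuffle_insertPerm, isUnshuffle_insertPerm, isUnshuffle_zero]
    simp [Fin.lt_succAbove_iff_le_castSucc]
  simp only [h]
  rw [Finset.sum_eq_single 1]
  · simp
  · intro τ _ hτ
    simp [hτ]
  · simp

end Permutations

section Products

variable {A : Type*} [CommRing A] [Algebra ℝ A]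

lemma prod_mem_exteriorPower {m : ℕ} {p : Fin m → ℕ} {v : Fin m → Multivector A}
    (hv : ∀ t, v t ∈ ⋀[A]^(p t) (VField A)) :
    (List.ofFn v).prod ∈ ⋀[A]^(∑ t, p t) (VField A) := by
  induction m with
  | zero => simp [ExteriorAlgebra.exteriorPower]
  | succ m ih =>
    rw [List.ofFn_succ, List.prod_cons, Fin.sum_univ_succ]
    exact mul_mem_exteriorPower (hv 0) (ih fun t => hv t.succ)

/-- Moving one factor of a wedge product to the front. -/
lemma prod_eq_sgn_smul_mul {m : ℕ} {p : Fin (m + 1) → ℕ} {v : Fin (m + 1) → Multivector A}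
    (hv : ∀ t, v t ∈ ⋀[A]^(p t) (VField A)) (i : Fin (m + 1)) :
    (List.ofFn v).prod = sgn (p i * sumBelow (fun t => (p t : ZMod 2)) i) •
      (v i * (List.ofFn fun t => v (i.succAbove t)).prod) := by
  induction m with
  | zero =>
    obtain rfl : i = 0 := Fin.eq_zero i
    simp
  | succ m ih =>
    refine Fin.cases ?_ (fun i => ?_) i
    · simp [List.ofFn_succ]
    · rw [List.ofFn_succ, List.prod_cons, ih (fun t => hv t.succ) i, sumBelow_succ,
        List.ofFn_succ, List.prod_cons]
      simp only [Fin.succ_succAbove_zero, Fin.succ_succAbove_succ]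
      rw [mul_smul_comm, ← mul_assoc, mul_comm_of_mem_exteriorPower (hv 0) (hv i.succ),
        smul_mul_assoc, smul_smul, ← sgn_add, mul_assoc]
      congr 2
      ring

/-- Reordering a wedge product produces the Koszul sign. -/
lemma prod_comp_perm {m : ℕ} {p : Fin m → ℕ} {v : Fin m → Multivector A}
    (hv : ∀ t, v t ∈ ⋀[A]^(p t) (VField A)) (σ : Equiv.Perm (Fin m)) :
    (List.ofFn fun t => v (σ t)).prod
      = sgn (koszulParity (fun t => (p t : ZMod 2)) σ) • (List.ofFn v).prod := by
  induction m with
  | zero => simp [koszulParity]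
  | succ m ih =>
    obtain ⟨i, τ, rfl⟩ := exists_insertPerm σ
    rw [List.ofFn_succ, List.prod_cons]
    simp only [insertPerm_zero, insertPerm_succ]
    rw [ih (p := fun t => p (i.succAbove t)) (v := fun t => v (i.succAbove t))
      (fun t => hv _) τ, prod_eq_sgn_smul_mul hv i,
      koszulParity_insertPerm, mul_smul_comm, smul_smul, sgn_add, mul_right_comm, sgn_mul_self,
      one_mul]

end Products

/-! ### The exterior derivative as a second order operator on contractions -/

section SecondOrder

variable {A : Type*} [CommRing A] [Algebra ℝ A]

/-- If the graded commutators of `D` with the contractions by `v t` are contractions by `c t`, then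
`D` acts on contractions by wedge products of the `v t` as a first order differential operator. -/
lemma commutator_contract_prod {D : Module.End ℝ (MixedForm A)} {r : ZMod 2} {m : ℕ}
    {p q : Fin (m + 1) → ℕ} {v c : Fin (m + 1) → Multivector A}
    (hv : ∀ t, v t ∈ ⋀[A]^(p t) (VField A)) (hc : ∀ t, c t ∈ ⋀[A]^(q t) (VField A))
    (hq : ∀ t, (q t : ZMod 2) = r + p t)
    (h : ∀ t, IsCommutator D r (v t) (p t) (c t)) (α : MixedForm A) :
    D (contract (List.ofFn v).prod α) =
      (∑ j, sgn (r * ∑ t, (p (j.succAbove t) : ZMod 2)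
          + p j * sumBelow (fun t => (p t : ZMod 2)) j) •
        contract (c j * (List.ofFn fun t => v (j.succAbove t)).prod) α)
      + sgn (r * ∑ t, (p t : ZMod 2)) • contract (List.ofFn v).prod (D α) := by
  induction m generalizing α with
  | zero => simpa using h 0 α
  | succ m ih =>
    rw [List.ofFn_succ, List.prod_cons, contract_mul,
      ih (fun t => hv t.succ) (fun t => hc t.succ) (fun t => hq t.succ) (fun t => h t.succ), h 0,
      contract_add_right, contract_smul_right, smul_add, smul_smul, ← sgn_add,
      ← contract_mul (v 0), ← contract_mul (c 0), Fin.sum_univ_succ (n := m + 1)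
        (f := fun j => sgn (r * _ + _ * sumBelow _ j) • _), ← add_assoc]
    congr 1
    · rw [add_comm]
      congr 1
      · simp
      · refine Finset.sum_congr rfl fun j _ => ?_
        rw [← contract_mul, List.ofFn_succ, List.prod_cons, sumBelow_succ, Fin.sum_univ_succ]
        simp only [Fin.succ_succAbove_zero, Fin.succ_succAbove_succ]
        rw [← mul_assoc, ← mul_assoc, mul_comm_of_mem_exteriorPower (hv 0) (hc j.succ), hq,
          smul_mul_assoc, contract_smul_left, smul_smul, ← sgn_add]
        congr 2
        ring
    · congr 2
      rw [Fin.sum_univ_succ (f := fun t => (p t : ZMod 2))]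
      ring

/-- The exterior derivative is a second order differential operator with respect to contractions:
on a wedge product of multivector fields whose contractions with the closed form `η` are closed,
`d` is determined by its values on pairs. -/
lemma d_contract_prod {η : MixedForm A} (hη : d A η = 0) {m : ℕ} {j : Fin (m + 2) → ℕ}
    {v : Fin (m + 2) → Multivector A} (hv : ∀ t, v t ∈ ⋀[A]^(j t + 1) (VField A))
    (hd : ∀ t, d A (contract (v t) η) = 0) {p : Fin (m + 2) → ZMod 2}
    (hp : ∀ t, p t = (j t + 1 : ℕ)) :
    d A (contract (List.ofFn v).prod η) =
      ∑ a : Fin (m + 2), ∑ b : Fin (m + 1), if a ≤ b.castSucc then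
        sgn (p a * sumBelow p a
            + p (a.succAbove b) * sumBelow (fun t => p (a.succAbove t)) b
            + ∑ t, p (a.succAbove (b.succAbove t))) •
          contract (List.ofFn fun t => v (a.succAbove (b.succAbove t))).prod
            (d A (contract (v a * v (a.succAbove b)) η))
        else 0 := by
  induction m with
  | zero =>
    rw [Fin.sum_univ_two, Fin.sum_univ_one, Fin.sum_univ_one, if_pos (by simp), if_neg (by simp)]
    simp [contract_one, List.ofFn_succ]
  | succ m ih =>
    have hW := prod_mem_exteriorPower fun t : Fin (m + 2) => hv t.succ
    -- `c t` is the Schouten bracket of `v 0` and `v t.succ`.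
    choose c hc hc' using fun t : Fin (m + 2) => exists_isCommutator_lieOp (hv 0) (hv t.succ)
    have hE : lieOp (j 0 + 1 : ℕ) (v 0) η = 0 := by
      rw [lieOp_apply, hd, hη, contract_zero_right, smul_zero, sub_zero]
    have hcη : ∀ t : Fin (m + 2), contract (c t) η
        = sgn (p 0 * p t.succ) • d A (contract (v 0 * v t.succ) η) := by
      intro t
      have h := hc' t η
      rw [hE, contract_zero_right, smul_zero, add_zero, lieOp_apply, hd, contract_zero_right,
        smul_zero, sub_zero, ← contract_mul, mul_comm_of_mem_exteriorPower (hv t.succ) (hv 0),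
        contract_smul_left, map_smul] at h
      rw [← h, hp, hp, mul_comm]
    have hfirst := commutator_contract_prod (fun t => hv t.succ) hc
      (r := (j 0 + 2 : ℕ)) (fun t => by push_cast; grind) hc' η
    rw [hE, contract_zero_right, smul_zero, add_zero] at hfirst
    have hlie : ∀ β, d A (contract (v 0) β)
        = lieOp (j 0 + 1 : ℕ) (v 0) β + sgn (j 0 + 1 : ℕ) • contract (v 0) (d A β) := fun β => by
      rw [lieOp_apply, sub_add_cancel]
    -- With `ι_{v 0}` outermost, `d ι_{v 0} = [d, ι_{v 0}] ± ι_{v 0} d` yields the pairs containing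
    -- the index `0` from the commutator, and the other pairs from the induction hypothesis.
    rw [List.ofFn_succ, List.prod_cons, mul_comm_of_mem_exteriorPower (hv 0) hW,
      contract_smul_left, map_smul, contract_mul, hlie, hfirst,
      ih (fun t => hv t.succ) (fun t => hd t.succ) (p := fun t => p t.succ) (fun t => hp t.succ),
      smul_add, Fin.sum_univ_succ (n := m + 2) (f := fun a => ∑ b, _)]
    congr 1
    · rw [Finset.smul_sum]
      refine Finset.sum_congr rfl fun b _ => ?_
      rw [if_pos (Fin.zero_le _), contract_mul, hcη, contract_smul_right, smul_smul, smul_smul,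
        ← sgn_add, ← sgn_add]
      simp only [Fin.zero_succAbove, sumBelow_zero, ← hp, Nat.cast_sum]
      rw [Fin.sum_univ_succAbove _ b]
      congr 2
      have h0 : ((j 0 + 2 : ℕ) : ZMod 2) = p 0 + 1 := by rw [hp]; push_cast; ring
      rw [h0]
      grind
    · rw [smul_smul, contract_sum_right, Finset.smul_sum]
      refine Finset.sum_congr rfl fun a _ => ?_
      rw [contract_sum_right, Finset.smul_sum,
        Fin.sum_univ_succ (f := fun b => ite (a.succ ≤ _) _ _), if_neg (by simp), zero_add]
      refine Finset.sum_congr rfl fun b _ => ?_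
      rw [← Fin.succ_castSucc]
      simp only [Fin.succ_le_succ_iff]
      split_ifs
      · have hR := prod_mem_exteriorPower fun t : Fin m =>
          hv (a.succAbove (b.succAbove t)).succ
        have hsum : ((∑ t : Fin (m + 2), (j t.succ + 1) : ℕ) : ZMod 2) = p a.succ
            + (p (a.succAbove b).succ + ∑ t, p (a.succAbove (b.succAbove t)).succ) := by
          rw [Nat.cast_sum, Fin.sum_univ_succAbove _ a, Fin.sum_univ_succAbove _ b]
          simp only [← hp]
        rw [contract_smul_right, smul_smul, ← contract_mul, hsum]
        simp only [Fin.succ_succAbove_succ, Fin.succ_succAbove_zero, List.ofFn_succ,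
          List.prod_cons, sumBelow_succ, Fin.sum_univ_succ]
        rw [mul_comm_of_mem_exteriorPower (hv 0) hR, contract_smul_left, smul_smul, ← sgn_add,
          ← sgn_add, ← sgn_add]
        congr 2
        simp only [← hp, Nat.cast_sum]
        grind
      · rw [contract_zero_right, smul_zero]

end SecondOrder

/-! ### Hamiltonian forms and observables -/

section Hamiltonian

variable {A : Type*} [CommRing A] [Algebra ℝ A]

/-- The second order formula for `d` on contractions, as a sum over `(2, m)`-unshuffles. -/
lemma d_contract_prod_unshuffle {η : MixedForm A} (hη : d A η = 0) {m : ℕ} {j : Fin (m + 2) → ℕ}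
    {v : Fin (m + 2) → Multivector A} (hv : ∀ t, v t ∈ ⋀[A]^(j t + 1) (VField A))
    (hd : ∀ t, d A (contract (v t) η) = 0) {p : Fin (m + 2) → ZMod 2}
    (hp : ∀ t, p t = (j t + 1 : ℕ)) :
    d A (contract (List.ofFn v).prod η) =
      ∑ σ : Equiv.Perm (Fin (m + 2)) with IsUnshuffle 2 σ,
        sgn (koszulParity p σ + ∑ t : Fin m, p (σ t.succ.succ)) •
          contract (List.ofFn fun t : Fin m => v (σ t.succ.succ)).prod
            (d A (contract (v (σ 0) * v (σ 1)) η)) := by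
  rw [d_contract_prod hη hv hd hp, sum_isUnshuffle_two]
  refine Finset.sum_congr rfl fun a _ => Finset.sum_congr rfl fun b _ => ?_
  rw [koszulParity_insertPerm, koszulParity_insertPerm, koszulParity_one, add_zero,
    ← Fin.succ_zero_eq_one]
  simp only [insertPerm_zero, insertPerm_succ, Equiv.Perm.one_apply]

/-- The contraction of `η` by a wedge product of homogeneous multivector fields depends on the
factors only through their contractions with `η`. -/
lemma contract_prod_congr {η : MixedForm A} {m : ℕ} {p : Fin m → ℕ} {v w : Fin m → Multivector A}
    (hv : ∀ t, v t ∈ ⋀[A]^(p t) (VField A)) (hw : ∀ t, w t ∈ ⋀[A]^(p t) (VField A))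
    (h : ∀ t, contract (v t) η = contract (w t) η) :
    contract (List.ofFn v).prod η = contract (List.ofFn w).prod η := by
  induction m with
  | zero => simp
  | succ m ih =>
    have ih' := ih (fun t => hv t.succ) (fun t => hw t.succ) fun t => h t.succ
    have hV := prod_mem_exteriorPower fun t : Fin m => hv t.succ
    have hW := prod_mem_exteriorPower fun t : Fin m => hw t.succ
    rw [List.ofFn_succ, List.ofFn_succ, List.prod_cons, List.prod_cons, contract_mul, h 0,
      ← contract_mul, mul_comm_of_mem_exteriorPower (hw 0) hV,
      mul_comm_of_mem_exteriorPower (hw 0) hW, contract_smul_left, contract_smul_left,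
      contract_mul, contract_mul, ih']

/-- The wedge product of two Hamiltonian multivector fields contracts with `η` to a Hamiltonian
form. -/
lemma exists_d_contract_mul {η : MixedForm A} (hη : d A η = 0) {p q : ℕ} {v w : Multivector A}
    (hv : v ∈ ⋀[A]^(p + 1) (VField A)) (hw : w ∈ ⋀[A]^(q + 1) (VField A))
    (hdv : d A (contract v η) = 0) (hdw : d A (contract w η) = 0) :
    ∃ c ∈ ⋀[A]^(p + q + 1) (VField A), d A (contract (v * w) η) = contract c η := by
  obtain ⟨c, hc, hc'⟩ := exists_isCommutator_lieOp hv hw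
  refine ⟨sgn ((p + 1 : ℕ) * (q + 1 : ℕ)) • c, real_smul_mem_exteriorPower _ hc, ?_⟩
  have h := hc' η
  rw [lieOp_apply, lieOp_apply, hdv, hdw, hη, contract_zero_right, smul_zero,
    sub_zero, sub_zero, contract_zero_right, smul_zero, add_zero, ← contract_mul] at h
  rw [mul_comm_of_mem_exteriorPower hv hw, contract_smul_left, contract_smul_left, map_smul, h]

lemma d_contract_of_isHamiltonianFor {η α : MixedForm A} {k : ℕ} {v : Multivector A}
    (h : IsHamiltonianFor η k α v) : d A (contract v η) = 0 := by
  rw [← neg_eq_zero, ← map_neg, ← h.2, d_d]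

lemma d_mem_formsOfDegree {q : ℤ} {α : MixedForm A} (hα : α ∈ formsOfDegree A q) :
    d A α ∈ formsOfDegree A (q + 1) := by
  intro p hp
  cases p with
  | zero => rfl
  | succ p => rw [d_succ_apply, hα p (by push_cast at hp; omega), map_zero]

lemma contractField_mem_formsOfDegree {q : ℤ} {α : MixedForm A} (hα : α ∈ formsOfDegree A q)
    (X : VField A) : contractField X α ∈ formsOfDegree A (q - 1) := by
  intro p hp
  ext Y
  rw [contractField_apply, hα (p + 1) (by push_cast; omega)]
  rfl

lemma contract_mem_formsOfDegree {q : ℤ} {α : MixedForm A} (hα : α ∈ formsOfDegree A q) {p : ℕ}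
    {v : Multivector A} (hv : v ∈ ⋀[A]^p (VField A)) :
    contract v α ∈ formsOfDegree A (q - p) := by
  induction p, v, hv using exteriorPower_induction generalizing q α with
  | zero v hv =>
    rw [ExteriorAlgebra.exteriorPower, pow_zero, Submodule.mem_one] at hv
    obtain ⟨f, rfl⟩ := hv
    rw [Algebra.algebraMap_eq_smul_one, contract_smul, contract_one]
    intro p hp
    rw [Pi.smul_apply, hα p (by simpa using hp), smul_zero]
  | add p v hv w hw ihv ihw =>
    rw [contract_add]
    exact add_mem (ihv hα) (ihw hα)
  | mul p X v hv ih _ =>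
    rw [contract_mul, contract_ι]
    have := ih (contractField_mem_formsOfDegree hα X)
    rwa [show q - 1 - p = q - (p + 1 : ℕ) by push_cast; ring] at this

lemma ofForm_mem_formsOfDegree {p : ℕ} (η : Form A p) : ofForm η ∈ formsOfDegree A p := by
  intro q hq
  exact Pi.single_eq_of_ne (by exact_mod_cast hq) η

lemma d_ofForm {p : ℕ} {η : Form A p} (h : exteriorDeriv p η = 0) : d A (ofForm η) = 0 := by
  funext q
  cases q with
  | zero => rfl
  | succ q =>
    rw [d_succ_apply]
    by_cases hq : q = p
    · subst hq
      rw [ofForm, Pi.single_eq_same, h]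
      rfl
    · rw [ofForm, Pi.single_eq_of_ne hq, map_zero]
      rfl

variable {n : ℕ} {η : Form A (n + 1)}

lemma mem_observables_zero {j : ℕ} {α : MixedForm A} :
    α ∈ observables n η (0, (j : ℤ)) ↔ α ∈ hamiltonianForms n η (j + 1) := by
  have h1 : ¬ ((0 : ℤ) < 0 ∨ (j : ℤ) < 0) := by omega
  simp only [observables, h1, if_false, if_true, Int.toNat_natCast]

lemma mem_observables_iff_of_one_le {a : ℤ × ℤ} {α : MixedForm A} (h : 1 ≤ a.1) :
    α ∈ observables n η a ↔ (a.2 < 0 ∧ α = 0) ∨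
      (0 ≤ a.2 ∧ α ∈ formsOfDegree A ((n : ℤ) - a.1 - a.2 - 1)) := by
  unfold observables
  by_cases h2 : a.2 < 0
  · simp [h2]
  · rw [if_neg (by omega), if_neg (by omega)]
    simp [h2, not_lt.1 h2]

/-- The exterior derivative lowers the first degree by one. On the part of first degree one it
takes values in exact forms, which are Hamiltonian with Hamiltonian multivector field `0`. -/
lemma d_mem_observables {a : ℤ × ℤ} (h : 1 ≤ a.1) {α : MixedForm A}
    (hα : α ∈ observables n η a) : d A α ∈ observables n η (a.1 - 1, a.2) := by
  obtain ⟨i, j⟩ := a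
  simp only at h
  rcases (mem_observables_iff_of_one_le h).1 hα with ⟨_, rfl⟩ | ⟨hj, hα⟩
  · rw [map_zero]
    exact zero_mem _
  · simp only at hj hα
    lift j to ℕ using hj
    have hd := d_mem_formsOfDegree hα
    rcases h.eq_or_lt with rfl | h
    · rw [sub_self, mem_observables_zero]
      refine ⟨?_, 0, zero_mem _, ?_⟩
      · rwa [show (n : ℤ) - 1 - j - 1 + 1 = n - (j + 1 : ℕ) by push_cast; ring] at hd
      · rw [d_d, contract_zero_left, neg_zero]
    · rw [mem_observables_iff_of_one_le (by simp only; omega)]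
      refine Or.inr ⟨by simp, ?_⟩
      rwa [show (n : ℤ) - i - j - 1 + 1 = n - (i - 1) - j - 1 by ring] at hd

/-- Wedge products of Hamiltonian multivector fields contract with `η` to observables. -/
lemma contract_prod_mem_observables (hη : exteriorDeriv (n + 1) η = 0) {k : ℕ} (hk : 2 ≤ k)
    {j : Fin k → ℕ} {v : Fin k → Multivector A} (hv : ∀ t, v t ∈ ⋀[A]^(j t + 1) (VField A))
    (hd : ∀ t, d A (contract (v t) (ofForm η)) = 0) :
    contract (List.ofFn v).prod (ofForm η) ∈
      observables n η ((k : ℤ) - 2, ((∑ t, j t : ℕ) : ℤ)) := by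
  have hdeg := contract_mem_formsOfDegree (ofForm_mem_formsOfDegree η) (prod_mem_exteriorPower hv)
  have hs : ((n + 1 : ℕ) : ℤ) - (∑ t, (j t + 1) : ℕ) = n - ((k : ℤ) - 2) - (∑ t, j t : ℕ) - 1 := by
    rw [Finset.sum_add_distrib]
    push_cast
    simp
    ring_nf
  rw [hs] at hdeg
  rcases hk.eq_or_lt with rfl | hk
  · rw [show ((2 : ℕ) : ℤ) - 2 = 0 by norm_num, mem_observables_zero]
    refine ⟨?_, ?_⟩
    · convert hdeg using 1
      push_cast
      ring_nf
    · obtain ⟨c, hc, hc'⟩ := exists_d_contract_mul (d_ofForm hη) (hv 0) (hv 1) (hd 0) (hd 1)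
      refine ⟨-c, ?_, ?_⟩
      · rw [Fin.sum_univ_two]
        exact neg_mem hc
      · rw [contract_neg_left, neg_neg, ← hc']
        simp [List.ofFn_succ]
  · rw [mem_observables_iff_of_one_le (by simp only; omega)]
    exact Or.inr ⟨by positivity, hdeg⟩

variable (η) in
/-- The linear map `v ↦ ι_v η` on multivector fields of degree `k` has a linear right inverse on its
range, as real vector spaces are projective; it extends to all mixed forms. -/
lemma exists_hamiltonianSection (k : ℕ) :
    ∃ s : MixedForm A →ₗ[ℝ] Multivector A, ∀ v ∈ ⋀[A]^k (VField A),
      s (contract v (ofForm η)) ∈ ⋀[A]^k (VField A) ∧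
        contract (s (contract v (ofForm η))) (ofForm η) = contract v (ofForm η) := by
  let g : (⋀[A]^k (VField A)).restrictScalars ℝ →ₗ[ℝ] MixedForm A :=
    contractLin.flip (ofForm η) ∘ₗ Submodule.subtype _
  have : Module.Free ℝ g.range := Module.Free.of_divisionRing ℝ g.range
  have : Module.Projective ℝ g.range := Module.Projective.of_free
  obtain ⟨h, hh⟩ := g.rangeRestrict.exists_rightInverse_of_surjective g.range_rangeRestrict
  obtain ⟨s, hs⟩ := LinearMap.exists_extend h
  refine ⟨Submodule.subtype _ ∘ₗ s, fun v hv => ?_⟩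
  have h1 : s (contract v (ofForm η)) = h (g.rangeRestrict ⟨v, hv⟩) := by
    rw [← hs]
    rfl
  refine ⟨(s _).2, ?_⟩
  have h2 := congrArg Subtype.val (LinearMap.congr_fun hh (g.rangeRestrict ⟨v, hv⟩))
  rw [LinearMap.comp_apply, h1]
  exact h2

end Hamiltonian

/-! ### The brackets -/

section Total

variable (L : ℤ × ℤ → Type*) [∀ a, AddCommGroup (L a)] [∀ a, Module ℝ (L a)]

/-- The inclusion of the part of bidegree `a` in the total space of a bigraded vector space. -/
def incl (a : ℤ × ℤ) : L a →ₗ[ℝ] ⨁ a, L a :=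
  DirectSum.lof ℝ _ L a

variable {L}

/-- The linear map on the total space with given restrictions to the parts of each bidegree. -/
def totalLift {N : Type*} [AddCommMonoid N] [Module ℝ N] (f : ∀ a, L a →ₗ[ℝ] N) :
    (⨁ a, L a) →ₗ[ℝ] N :=
  DirectSum.toModule ℝ _ N f

lemma totalLift_incl {N : Type*} [AddCommMonoid N] [Module ℝ N] (f : ∀ a, L a →ₗ[ℝ] N)
    (a : ℤ × ℤ) (x : L a) : totalLift f (incl L a x) = f a x :=
  DirectSum.toModule_lof ℝ a x

lemma incl_apply (a : ℤ × ℤ) (x : L a) : incl L a x a = x :=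
  DirectSum.lof_apply ℝ a x

end Total

section Brackets

variable {A : Type*} [CommRing A] [Algebra ℝ A] {n : ℕ} (η : Form A (n + 1))

/-- A real linear choice of multivector fields of degree `k` with prescribed contraction with `η`:
on contractions `ι_v η` it is a right inverse of `v ↦ ι_v η`. -/
def hamiltonianSection (k : ℕ) : MixedForm A →ₗ[ℝ] Multivector A :=
  (exists_hamiltonianSection η k).choose

/-- A real linear choice of Hamiltonian multivector fields of degree `k`. -/
def hamiltonianField (k : ℕ) : MixedForm A →ₗ[ℝ] Multivector A :=
  -(hamiltonianSection η k ∘ₗ d A)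

variable {η} in
lemma isHamiltonianFor_hamiltonianField {k : ℕ} {α : MixedForm A}
    (h : ∃ v, IsHamiltonianFor (ofForm η) k α v) :
    IsHamiltonianFor (ofForm η) k α (hamiltonianField η k α) := by
  obtain ⟨v, hv, hα⟩ := h
  obtain ⟨h1, h2⟩ := (exists_hamiltonianSection η k).choose_spec v hv
  have h3 : hamiltonianField η k α = hamiltonianSection η k (contract v (ofForm η)) := by
    rw [hamiltonianField, LinearMap.neg_apply, LinearMap.comp_apply, hα, map_neg, neg_neg]
  rw [h3]
  exact ⟨h1, by rw [hα]; exact congrArg _ h2.symm⟩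

lemma exists_observableProj (a : ℤ × ℤ) :
    ∃ f : MixedForm A →ₗ[ℝ] observables n η a,
      f ∘ₗ (observables n η a).subtype = LinearMap.id :=
  LinearMap.exists_extend (K := ℝ) (V := MixedForm A) (V' := observables n η a)
    (p := observables n η a) LinearMap.id

/-- A real linear projection of mixed forms to the observables of bidegree `a`. -/
def observableProj (a : ℤ × ℤ) : MixedForm A →ₗ[ℝ] observables n η a :=
  (exists_observableProj η a).choose

variable {η} in
lemma observableProj_coe {a : ℤ × ℤ} (x : observables n η a) : observableProj η a x = x :=
  LinearMap.congr_fun (exists_observableProj η a).choose_spec x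

/-- The total space of the bigraded vector space of observables. -/
abbrev TotalObservables : Type _ :=
  @DirectSum (ℤ × ℤ) (fun a => observables n η a) fun _ => AddCommGroup.toAddCommMonoid

/-- The homogeneous element of bidegree `a` with coefficient `α`, if `α` is an observable of that
bidegree. (Other forms are first projected to the observables.) -/
def homogeneous (a : ℤ × ℤ) : MixedForm A →ₗ[ℝ] TotalObservables η :=
  incl (fun a => observables n η a) a ∘ₗ observableProj η a

variable {η}

lemma homogeneous_coe {a : ℤ × ℤ} (x : observables n η a) :
    homogeneous η a (x : MixedForm A) = incl (fun a => observables n η a) a x := by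
  rw [homogeneous, LinearMap.comp_apply, observableProj_coe]

lemma homogeneous_apply {a : ℤ × ℤ} {α : MixedForm A} (h : α ∈ observables n η a) :
    (homogeneous η a α a : MixedForm A) = α := by
  have := homogeneous_coe ⟨α, h⟩
  simp only at this
  rw [this]
  exact congrArg Subtype.val (incl_apply (L := fun a => observables n η a) a ⟨α, h⟩)

lemma homogeneous_mem_range {a b : ℤ × ℤ} (h : a = b) (α : MixedForm A) :
    homogeneous η a α ∈ LinearMap.range (incl (fun a => observables n η a) b) := by
  subst h
  exact ⟨observableProj η a α, rfl⟩

variable (η) in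
/-- The unary bracket: the exterior derivative on elements of positive first degree. -/
def unaryBracket : TotalObservables η →ₗ[ℝ] TotalObservables η :=
  totalLift (L := fun a => observables n η a) fun a =>
    if 1 ≤ a.1 then homogeneous η (a.1 - 1, a.2) ∘ₗ d A ∘ₗ (observables n η a).subtype else 0

lemma unaryBracket_homogeneous {a : ℤ × ℤ} (h : 1 ≤ a.1) {α : MixedForm A}
    (hα : α ∈ observables n η a) :
    unaryBracket η (homogeneous η a α) = homogeneous η (a.1 - 1, a.2) (d A α) := by
  rw [show homogeneous η a α = _ from homogeneous_coe ⟨α, hα⟩, unaryBracket,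
    totalLift_incl, if_pos h]
  rfl

lemma unaryBracket_homogeneous_of_lt {a : ℤ × ℤ} (h : a.1 < 1) (α : MixedForm A) :
    unaryBracket η (homogeneous η a α) = 0 := by
  rw [homogeneous, LinearMap.comp_apply, unaryBracket, totalLift_incl,
    if_neg (not_le.2 h)]
  rfl

variable (η) in
/-- The multivector-valued polynomial in `u` attached to the `t`-th argument of a bracket: an
element `α u^j` of `L_{0,j}` goes to `v u^j` with a Hamiltonian multivector field `v` of `α`, up to
the sign that the position of the argument contributes. Elements of positive first degree go
to `0`. -/
def slot (t : ℕ) : TotalObservables η →ₗ[ℝ] Polynomial (Multivector A) :=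
  totalLift (L := fun a => observables n η a) fun a =>
    if a.1 = 0 ∧ 0 ≤ a.2 then
      sgn (t * (a.2.toNat + 1 : ℕ)) • ((Polynomial.monomial a.2.toNat).restrictScalars ℝ ∘ₗ
        hamiltonianField η (a.2.toNat + 1) ∘ₗ (observables n η a).subtype)
    else 0

lemma slot_homogeneous_of_not {a : ℤ × ℤ} (h : ¬ (a.1 = 0 ∧ 0 ≤ a.2)) (t : ℕ) (α : MixedForm A) :
    slot η t (homogeneous η a α) = 0 := by
  rw [homogeneous, LinearMap.comp_apply, slot, totalLift_incl, if_neg h]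
  rfl

lemma slot_homogeneous {j : ℕ} {α : MixedForm A} (hα : α ∈ observables n η (0, (j : ℤ))) (t : ℕ) :
    slot η t (homogeneous η (0, (j : ℤ)) α) =
      sgn (t * (j + 1 : ℕ)) • Polynomial.monomial j (hamiltonianField η (j + 1) α) := by
  rw [show homogeneous η _ α = _ from homogeneous_coe ⟨α, hα⟩, slot,
    totalLift_incl, if_pos ⟨rfl, by simp⟩]
  rfl

/-- Exact forms have Hamiltonian multivector field `0`, so `l₁` takes values in elements that all
higher brackets annihilate. -/
lemma slot_unaryBracket (t : ℕ) (a : ℤ × ℤ) (x : observables n η a) :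
    slot η t (unaryBracket η (incl (fun a => observables n η a) a x)) = 0 := by
  rw [← homogeneous_coe]
  by_cases h : 1 ≤ a.1
  · rw [unaryBracket_homogeneous h x.2]
    by_cases h2 : a.1 - 1 = 0 ∧ 0 ≤ a.2
    · have hd := d_mem_observables h x.2
      obtain ⟨i, j⟩ := a
      obtain ⟨h2, h3⟩ := h2
      simp only at h2 h3 hd ⊢
      lift j to ℕ using h3
      rw [h2] at hd ⊢
      rw [slot_homogeneous hd, hamiltonianField, LinearMap.neg_apply, LinearMap.comp_apply, d_d]
      simp
    · exact slot_homogeneous_of_not h2 t _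
  · rw [unaryBracket_homogeneous_of_lt (not_le.1 h), map_zero]

lemma unaryBracket_unaryBracket (a : ℤ × ℤ) (x : observables n η a) :
    unaryBracket η (unaryBracket η (incl (fun a => observables n η a) a x)) = 0 := by
  rw [← homogeneous_coe]
  by_cases h : 1 ≤ a.1
  · rw [unaryBracket_homogeneous h x.2]
    by_cases h2 : 1 ≤ a.1 - 1
    · rw [unaryBracket_homogeneous h2 (d_mem_observables h x.2), d_d, map_zero]
    · exact unaryBracket_homogeneous_of_lt (not_le.1 h2) _
  · rw [unaryBracket_homogeneous_of_lt (not_le.1 h), map_zero]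

variable (η) in
/-- The observable of first degree `i` obtained from a multivector-valued polynomial in `u` by
contraction with `η`. -/
def contractPolynomial (i : ℤ) : Polynomial (Multivector A) →ₗ[ℝ] TotalObservables η :=
  Polynomial.lsum fun J => homogeneous η (i, (J : ℤ)) ∘ₗ contractLin.flip (ofForm η)

lemma contractPolynomial_monomial (i : ℤ) (J : ℕ) (v : Multivector A) :
    contractPolynomial η i (Polynomial.monomial J v)
      = homogeneous η (i, (J : ℤ)) (contract v (ofForm η)) := by
  rw [contractPolynomial, Polynomial.lsum_apply, Polynomial.sum_monomial_index _ _ (by simp)]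
  rfl

variable (η) in
/-- The brackets on observables. For `k ≥ 2` the bracket multiplies Hamiltonian multivector fields
of its arguments and contracts the product with `η`. -/
def observableBracket : (k : ℕ) →
    MultilinearMap ℝ (fun _ : Fin k => TotalObservables η) (TotalObservables η)
  | 0 => 0
  | 1 => MultilinearMap.ofSubsingleton ℝ _ _ (0 : Fin 1) (unaryBracket η)
  | k + 2 => (contractPolynomial η ((k + 2 : ℕ) - 2 : ℤ)).compMultilinearMap
      ((MultilinearMap.mkPiAlgebraFin ℝ (k + 2) (Polynomial (Multivector A))).compLinearMap
        fun t => slot η t)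

lemma observableBracket_one {k : ℕ} (hk : k = 1) (z : Fin k → TotalObservables η) :
    observableBracket η k z = unaryBracket η (z ⟨0, by omega⟩) := by
  subst hk
  rfl

lemma observableBracket_of_two_le {k : ℕ} (hk : 2 ≤ k) (z : Fin k → TotalObservables η) :
    observableBracket η k z
      = contractPolynomial η ((k : ℤ) - 2) (List.ofFn fun t : Fin k => slot η t (z t)).prod := by
  obtain ⟨k, rfl⟩ := Nat.exists_eq_add_of_le' hk
  rfl

lemma observableBracket_eq_zero {k : ℕ} (hk : 2 ≤ k) {z : Fin k → TotalObservables η} (t : Fin k)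
    (h : slot η t (z t) = 0) : observableBracket η k z = 0 := by
  rw [observableBracket_of_two_le hk, List.prod_eq_zero, map_zero]
  rw [← h]
  exact (List.mem_ofFn' _ _).2 ⟨t, rfl⟩

lemma prod_smul_monomial {R : Type*} [Ring R] [Algebra ℝ R] {k : ℕ} (e : Fin k → ZMod 2)
    (j : Fin k → ℕ) (v : Fin k → R) :
    (List.ofFn fun t => sgn (e t) • Polynomial.monomial (j t) (v t)).prod
      = sgn (∑ t, e t) • Polynomial.monomial (∑ t, j t) (List.ofFn v).prod := by
  induction k with
  | zero => simp
  | succ k ih =>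
    rw [List.ofFn_succ, List.prod_cons, ih, List.ofFn_succ, List.prod_cons, Fin.sum_univ_succ,
      Fin.sum_univ_succ, smul_mul_smul_comm, Polynomial.monomial_mul_monomial, sgn_add]

/-- The value of the higher brackets, for arbitrary Hamiltonian multivector fields. -/
lemma observableBracket_homogeneous {k : ℕ} (hk : 2 ≤ k) {z : Fin k → TotalObservables η}
    {j : Fin k → ℕ} {α : Fin k → MixedForm A} {v : Fin k → Multivector A}
    (hz : ∀ t, z t = homogeneous η (0, (j t : ℤ)) (α t))
    (hα : ∀ t, α t ∈ observables n η (0, (j t : ℤ)))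
    (hv : ∀ t, IsHamiltonianFor (ofForm η) (j t + 1) (α t) (v t)) :
    observableBracket η k z = sgn (∑ t : Fin k, (t : ℕ) * (j t + 1 : ℕ)) •
      homogeneous η ((k : ℤ) - 2, ((∑ t, j t : ℕ) : ℤ))
        (contract (List.ofFn v).prod (ofForm η)) := by
  have hw := fun t => isHamiltonianFor_hamiltonianField ⟨v t, hv t⟩
  rw [observableBracket_of_two_le hk]
  simp only [hz, slot_homogeneous (hα _)]
  rw [prod_smul_monomial, map_smul, contractPolynomial_monomial,
    contract_prod_congr (fun t => (hw t).1) (fun t => (hv t).1)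
      fun t => neg_injective ((hw t).2.symm.trans (hv t).2)]

end Brackets

/-! ### Skew symmetry and the terms of the Jacobi identity -/

section SkewSymmetry

variable {A : Type*} [CommRing A] [Algebra ℝ A] {n : ℕ} {η : Form A (n + 1)}

/-- A homogeneous element either lies outside `L_{0,•}` and is killed by all slots, or it is
`α u^j` for a Hamiltonian form `α`. -/
lemma slot_eq_zero_or_exists_isHamiltonianFor (a : ℤ × ℤ) (x : observables n η a) :
    (∀ t, slot η t (incl (fun a => observables n η a) a x) = 0) ∨
      ∃ (j : ℕ) (α : MixedForm A) (v : Multivector A), a = (0, (j : ℤ)) ∧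
        incl (fun a => observables n η a) a x = homogeneous η (0, (j : ℤ)) α ∧
        α ∈ observables n η (0, (j : ℤ)) ∧ IsHamiltonianFor (ofForm η) (j + 1) α v := by
  rw [← homogeneous_coe]
  by_cases h : a.1 = 0 ∧ 0 ≤ a.2
  · right
    obtain ⟨i, j⟩ := a
    obtain ⟨hi, hj⟩ := h
    simp only at hi hj
    lift j to ℕ using hj
    subst hi
    obtain ⟨v, hv⟩ := (mem_observables_zero.1 x.2).2
    exact ⟨j, x, v, rfl, rfl, x.2, hv⟩
  · exact Or.inl fun t => slot_homogeneous_of_not h t _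

lemma intUnits_smul_eq {V : Type*} [AddCommGroup V] [Module ℝ V] (u : ℤˣ) (x : V) :
    u • x = ((u : ℤ) : ℝ) • x := by
  rw [Units.smul_def, Int.cast_smul_eq_zsmul]

lemma koszulSign_one {m : ℕ} (deg : Fin m → ℤ) : koszulSign deg 1 = 1 := by
  refine Finset.prod_eq_one fun s _ => Finset.prod_eq_one fun t _ => if_neg ?_
  rintro ⟨h1, h2⟩
  exact lt_asymm h1 h2

/-- The sign of a permutation of arguments of an `L∞`-bracket, in terms of the degrees of the
Hamiltonian multivector fields. -/
lemma sign_mul_koszulSign {k : ℕ} (j : Fin k → ℕ) {a : Fin k → ℤ × ℤ}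
    (ha : ∀ t, a t = (0, (j t : ℤ))) (σ : Equiv.Perm (Fin k)) :
    (((Equiv.Perm.sign σ * koszulSign (fun t => totalDegree (a t)) σ : ℤˣ) : ℤ) : ℝ)
      = sgn (∑ t : Fin k, ((t : ℕ) : ZMod 2) * (j (σ t) + 1 : ℕ)
          + ∑ t : Fin k, ((t : ℕ) : ZMod 2) * (j t + 1 : ℕ)
          + koszulParity (fun t => ((j t + 1 : ℕ) : ZMod 2)) σ) := by
  have h := koszulSign_shift (fun t => (j t : ZMod 2)) σ
  rw [Units.val_mul, Int.cast_mul, koszulSign_eq_sgn]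
  simp only [ha, totalDegree, zero_add, Int.cast_natCast, Nat.cast_add, Nat.cast_one]
  exact h

/-- Graded skew-symmetry of the brackets. The wedge product of the Hamiltonian multivector fields is
reordered with Koszul signs for their degrees `j t + 1`; by `koszulSign_shift` this matches the
required sign for the degrees `j t`. -/
lemma observableBracket_comp_perm {k : ℕ} (hk : 1 ≤ k) {a : Fin k → ℤ × ℤ}
    {x : ∀ t, observables n η (a t)} {y : Fin k → TotalObservables η}
    (hy : ∀ t, y t = incl (fun a => observables n η a) (a t) (x t)) (σ : Equiv.Perm (Fin k)) :
    observableBracket η k (fun t => y (σ t))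
      = (Equiv.Perm.sign σ * koszulSign (fun t => totalDegree (a t)) σ) •
        observableBracket η k y := by
  rcases hk.eq_or_lt with rfl | hk
  · obtain rfl := Subsingleton.elim σ 1
    rw [koszulSign_one, Equiv.Perm.sign_one, one_mul]
    simp
  by_cases h : ∃ t, ∀ s, slot η s (y t) = 0
  · obtain ⟨t, ht⟩ := h
    obtain ⟨s, rfl⟩ := σ.surjective t
    have h1 : observableBracket η k y = 0 := observableBracket_eq_zero hk (σ s) (ht _)
    have h2 : observableBracket η k (fun t => y (σ t)) = 0 := observableBracket_eq_zero hk s (ht _)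
    rw [h1, h2, smul_zero]
  · choose j α v ha hx hα hv using fun t =>
      (slot_eq_zero_or_exists_isHamiltonianFor (a t) (x t)).resolve_left fun h' =>
        h ⟨t, by rwa [hy]⟩
    replace hx := fun t => (hy t).trans (hx t)
    rw [observableBracket_homogeneous hk (fun t => hx (σ t)) (fun t => hα (σ t))
      (fun t => hv (σ t)), observableBracket_homogeneous hk hx hα hv,
      prod_comp_perm (fun t => (hv t).1), contract_smul_left, map_smul, intUnits_smul_eq,
      sign_mul_koszulSign j ha, smul_smul, smul_smul, Equiv.sum_comp σ j, ← sgn_add, ← sgn_add]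
    congr 2
    grind

end SkewSymmetry

section Jacobi

variable {A : Type*} [CommRing A] [Algebra ℝ A] {n : ℕ} {η : Form A (n + 1)}

/-- The composition of two brackets in the generalized Jacobi identity: the inner bracket has
`i + 1` arguments. -/
def nestedBracket {m : ℕ} (y : Fin m → TotalObservables η) (i : Fin m) (σ : Equiv.Perm (Fin m)) :
    TotalObservables η :=
  observableBracket η (m - i) fun t : Fin (m - i) =>
    if (t : ℕ) = 0 then observableBracket η (i + 1) (fun s : Fin (i + 1) => y (σ ⟨s, by omega⟩))
    else y (σ ⟨i + t, by omega⟩)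

/-- The terms of the Jacobi identity whose inner bracket is `l₁` vanish. -/
lemma nestedBracket_of_eq_zero {m : ℕ} {a : Fin m → ℤ × ℤ} {x : ∀ t, observables n η (a t)}
    {y : Fin m → TotalObservables η}
    (hy : ∀ t, y t = incl (fun a => observables n η a) (a t) (x t))
    {i : Fin m} (hi : (i : ℕ) = 0) (σ : Equiv.Perm (Fin m)) :
    nestedBracket y i σ = 0 := by
  rw [nestedBracket]
  rcases (show m - i = 1 ∨ 2 ≤ m - i by omega) with h | h
  · rw [observableBracket_one h, if_pos rfl, observableBracket_one (by omega), hy,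
      unaryBracket_unaryBracket]
  · refine observableBracket_eq_zero h ⟨0, by omega⟩ ?_
    rw [if_pos rfl, observableBracket_one (by omega), hy, slot_unaryBracket]

/-- The terms whose inner bracket has at least two arguments vanish if some argument is annihilated
by all higher brackets. -/
lemma nestedBracket_of_slot_eq_zero {m : ℕ} {y : Fin m → TotalObservables η} {t : Fin m}
    (ht : ∀ s, slot η s (y t) = 0) {i : Fin m} (hi : 1 ≤ (i : ℕ)) (σ : Equiv.Perm (Fin m)) :
    nestedBracket y i σ = 0 := by
  obtain ⟨s, rfl⟩ := σ.surjective t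
  rw [nestedBracket]
  by_cases hs : (s : ℕ) ≤ i
  · refine MultilinearMap.map_coord_zero _ ⟨0, by omega⟩ ?_
    rw [if_pos rfl]
    exact observableBracket_eq_zero (by omega) ⟨s, by omega⟩ (ht _)
  · refine observableBracket_eq_zero (by omega) ⟨s - i, by omega⟩ ?_
    rw [if_neg (by simp only; omega)]
    have : (⟨i + (s - i), by omega⟩ : Fin m) = s := Fin.ext (by simp only; omega)
    simp only [this]
    exact ht _

variable {m : ℕ} {y : Fin m → TotalObservables η} {j : Fin m → ℕ} {α : Fin m → MixedForm A}
  {v : Fin m → Multivector A}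

/-- The terms with an inner bracket of at least three arguments and an outer one of at least two
vanish: the inner bracket has positive first degree. -/
lemma nestedBracket_of_two_le (hy : ∀ t, y t = homogeneous η (0, (j t : ℤ)) (α t))
    (hα : ∀ t, α t ∈ observables n η (0, (j t : ℤ)))
    (hv : ∀ t, IsHamiltonianFor (ofForm η) (j t + 1) (α t) (v t)) {i : Fin m}
    (hi : 2 ≤ (i : ℕ)) (hi' : (i : ℕ) + 2 ≤ m) (σ : Equiv.Perm (Fin m)) :
    nestedBracket y i σ = 0 := by
  rw [nestedBracket]
  refine observableBracket_eq_zero (by omega) ⟨0, by omega⟩ ?_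
  rw [if_pos rfl, observableBracket_homogeneous (by omega) (fun s => hy _) (fun s => hα _)
    (fun s => hv _), map_smul, slot_homogeneous_of_not, smul_zero]
  rintro ⟨h, -⟩
  push_cast at h
  omega

/-- The term `l₁ l_m` is the exterior derivative of a contraction. -/
lemma nestedBracket_last (hη : exteriorDeriv (n + 1) η = 0)
    (hy : ∀ t, y t = homogeneous η (0, (j t : ℤ)) (α t))
    (hα : ∀ t, α t ∈ observables n η (0, (j t : ℤ)))
    (hv : ∀ t, IsHamiltonianFor (ofForm η) (j t + 1) (α t) (v t)) (hm : 3 ≤ m) {i : Fin m}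
    (hi : (i : ℕ) + 1 = m) :
    nestedBracket y i 1 = sgn (∑ t : Fin m, (t : ℕ) * (j t + 1 : ℕ)) •
      homogeneous η ((m : ℤ) - 3, ((∑ t, j t : ℕ) : ℤ))
        (d A (contract (List.ofFn v).prod (ofForm η))) := by
  have hinner : observableBracket η (i + 1) (fun s : Fin (i + 1) =>
      y ((1 : Equiv.Perm (Fin m)) ⟨s, by omega⟩)) = observableBracket η m y := by
    obtain ⟨i, h⟩ := i
    simp only at hi
    subst hi
    rfl
  have hmem := contract_prod_mem_observables hη (by omega) (fun t => (hv t).1)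
    (fun t => d_contract_of_isHamiltonianFor (hv t))
  rw [nestedBracket, observableBracket_one (by omega), if_pos rfl, hinner,
    observableBracket_homogeneous (by omega) hy hα hv, map_smul,
    unaryBracket_homogeneous (by simp only; omega) hmem]
  simp only
  rw [show (m : ℤ) - 2 - 1 = m - 3 by ring]

/-- The term `l₁ l₂` vanishes, since `l₂` of two Hamiltonian forms has first degree `0`. -/
lemma nestedBracket_two_eq_zero (hy : ∀ t, y t = homogeneous η (0, (j t : ℤ)) (α t))
    (hα : ∀ t, α t ∈ observables n η (0, (j t : ℤ)))
    (hv : ∀ t, IsHamiltonianFor (ofForm η) (j t + 1) (α t) (v t)) (hm : m = 2) {i : Fin m}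
    (hi : (i : ℕ) = 1) (σ : Equiv.Perm (Fin m)) :
    nestedBracket y i σ = 0 := by
  rw [nestedBracket, observableBracket_one (by omega), if_pos rfl,
    observableBracket_homogeneous (by omega) (fun s => hy _) (fun s => hα _) (fun s => hv _),
    map_smul, unaryBracket_homogeneous_of_lt, smul_zero]
  push_cast
  omega

end Jacobi

section BinaryInnerBracket

variable {A : Type*} [CommRing A] [Algebra ℝ A] {n : ℕ} {η : Form A (n + 1)}
  {m : ℕ} {y : Fin (m + 3) → TotalObservables η} {j : Fin (m + 3) → ℕ}
  {α : Fin (m + 3) → MixedForm A} {v : Fin (m + 3) → Multivector A}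

/-- The terms `l_{m-1} l₂`. By the Schouten bracket, `l₂` of two Hamiltonian forms is Hamiltonian,
and contracting `η` with its Hamiltonian multivector field gives, up to sign, its exterior
derivative. -/
lemma nestedBracket_inner_two (hη : exteriorDeriv (n + 1) η = 0)
    (hy : ∀ t, y t = homogeneous η (0, (j t : ℤ)) (α t))
    (hα : ∀ t, α t ∈ observables n η (0, (j t : ℤ)))
    (hv : ∀ t, IsHamiltonianFor (ofForm η) (j t + 1) (α t) (v t))
    (σ : Equiv.Perm (Fin (m + 3))) :
    nestedBracket y ⟨1, by omega⟩ σ =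
      -(sgn (∑ t : Fin (m + 3), ((t : ℕ) : ZMod 2) * (j (σ t) + 1 : ℕ)
          + ∑ t : Fin (m + 1), ((j (σ t.succ.succ) + 1 : ℕ) : ZMod 2)) •
        homogeneous η (m, ((∑ t, j t : ℕ) : ℤ))
          (contract (List.ofFn fun t : Fin (m + 1) => v (σ t.succ.succ)).prod
            (d A (contract (v (σ 0) * v (σ 1)) (ofForm η))))) := by
  set e : ZMod 2 := ((j (σ 1) + 1 : ℕ) : ZMod 2) with he
  have hd := fun t => d_contract_of_isHamiltonianFor (hv t)
  have hinner : observableBracket η 2 (fun s : Fin 2 => y (σ ⟨s, by omega⟩))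
      = homogeneous η (0, ((j (σ 0) + j (σ 1) : ℕ) : ℤ))
        (sgn e • contract (v (σ 0) * v (σ 1)) (ofForm η)) := by
    rw [observableBracket_homogeneous le_rfl (fun s => hy _) (fun s => hα _) (fun s => hv _),
      map_smul]
    simp [List.ofFn_succ, Fin.sum_univ_two, he]
  have hβ : sgn e • contract (v (σ 0) * v (σ 1)) (ofForm η) ∈
      observables n η (0, ((j (σ 0) + j (σ 1) : ℕ) : ℤ)) := by
    refine Submodule.smul_mem _ _ ?_
    have := contract_prod_mem_observables hη le_rfl (j := ![j (σ 0), j (σ 1)])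
      (v := ![v (σ 0), v (σ 1)]) (fun t => by fin_cases t; exacts [(hv _).1, (hv _).1])
      (fun t => by fin_cases t; exacts [hd _, hd _])
    simpa [List.ofFn_succ, Fin.sum_univ_two] using this
  obtain ⟨c, hc, hc'⟩ := exists_d_contract_mul (d_ofForm hη) (hv (σ 0)).1 (hv (σ 1)).1
    (hd _) (hd _)
  have hu : IsHamiltonianFor (ofForm η) (j (σ 0) + j (σ 1) + 1)
      (sgn e • contract (v (σ 0) * v (σ 1)) (ofForm η)) (-sgn e • c) := by
    refine ⟨real_smul_mem_exteriorPower _ hc, ?_⟩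
    rw [map_smul, hc', contract_smul_left]
    module
  have houter : nestedBracket y ⟨1, by omega⟩ σ = observableBracket η (m + 2)
      (Fin.cons (homogeneous η (0, ((j (σ 0) + j (σ 1) : ℕ) : ℤ))
        (sgn e • contract (v (σ 0) * v (σ 1)) (ofForm η))) fun t => y (σ t.succ.succ)) := by
    rw [← hinner]
    change observableBracket η (m + 2) _ = _
    congr 1
    funext t
    refine Fin.cases ?_ (fun t => ?_) t
    · rfl
    · rw [Fin.cons_succ, if_neg (by simp)]
      congr 2
      ext
      simp
      omega
  rw [houter, observableBracket_homogeneous (by omega)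
    (j := Fin.cons (j (σ 0) + j (σ 1)) fun t => j (σ t.succ.succ))
    (α := Fin.cons _ fun t => α (σ t.succ.succ))
    (v := Fin.cons _ fun t => v (σ t.succ.succ))
    (fun t => Fin.cases rfl (fun t => hy _) t) (fun t => Fin.cases hβ (fun t => hα _) t)
    (fun t => Fin.cases hu (fun t => hv _) t)]
  rw [← Equiv.sum_comp σ j]
  simp only [Fin.sum_univ_succ (n := m + 1), Fin.sum_univ_succ (n := m + 2), Fin.cons_zero,
    Fin.cons_succ, List.ofFn_succ (n := m + 1), List.prod_cons]
  rw [contract_mul, contract_smul_left, ← hc', contract_smul_right, map_smul, smul_smul, ← neg_smul]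
  have hidx : (((m + 2 : ℕ) : ℤ) - 2) = m := by push_cast; ring
  rw [hidx, add_assoc (j (σ 0)) (j (σ 1)) (∑ t, _)]
  simp only [Fin.succ_zero_eq_one]
  congr 1
  rw [mul_neg, ← sgn_add]
  congr 2
  simp only [Fin.val_zero, Fin.val_succ, Nat.cast_zero, Nat.cast_succ, zero_mul, zero_add,
    Fin.val_one, one_mul, add_mul, Finset.sum_add_distrib, he]
  grind

end BinaryInnerBracket

/-! ### The graded `L∞`-algebra of observables -/

section Constructor

variable {L : ℤ × ℤ → Type*} [∀ a, AddCommGroup (L a)] [∀ a, Module ℝ (L a)]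

/-- A graded `L∞`-algebra from brackets whose properties are stated for families of homogeneous
elements `y t` of the total space. -/
def linfinityOfIncl
    (bracket : (k : ℕ) → MultilinearMap ℝ (fun _ : Fin k => ⨁ a, L a) (⨁ a, L a))
    (bidegree : ∀ (k : ℕ), 1 ≤ k → ∀ (a : Fin k → ℤ × ℤ) (x : ∀ t, L (a t)) (y : Fin k → ⨁ a, L a),
      (∀ t, y t = incl L (a t) (x t)) → bracket k y ∈
        LinearMap.range (incl L ((k : ℤ) - 2 + ∑ t, (a t).1, ∑ t, (a t).2)))
    (skew : ∀ (k : ℕ), 1 ≤ k → ∀ (a : Fin k → ℤ × ℤ) (x : ∀ t, L (a t)) (y : Fin k → ⨁ a, L a),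
      (∀ t, y t = incl L (a t) (x t)) → ∀ σ : Equiv.Perm (Fin k), bracket k (fun t => y (σ t)) =
        (Equiv.Perm.sign σ * koszulSign (fun t => totalDegree (a t)) σ) • bracket k y)
    (jacobi : ∀ (m : ℕ) (a : Fin m → ℤ × ℤ) (x : ∀ t, L (a t)) (y : Fin m → ⨁ a, L a),
      (∀ t, y t = incl L (a t) (x t)) →
      ∑ i : Fin m, ∑ σ : Equiv.Perm (Fin m) with IsUnshuffle (i + 1) σ,
        (Equiv.Perm.sign σ * koszulSign (fun t => totalDegree (a t)) σ *
            (-1) ^ (((i : ℕ) + 1) * (m - i - 1))) •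
          bracket (m - i) (fun t : Fin (m - i) =>
            if (t : ℕ) = 0 then
              bracket (i + 1) (fun s : Fin (i + 1) => y (σ ⟨s, by omega⟩))
            else y (σ ⟨i + t, by omega⟩)) = 0) :
    GradedLInfinityAlgebra L where
  bracket := bracket
  bidegree k hk a x := by
    have h := bidegree k hk a x (fun t => incl L (a t) (x t)) fun _ => rfl
    simp only [incl] at h
    exact h
  skew k hk a x σ := by
    have h := skew k hk a x (fun t => incl L (a t) (x t)) (fun _ => rfl) σ
    simp only [incl] at h
    exact h
  jacobi m _ a x := by
    have h := jacobi m a x (fun t => incl L (a t) (x t)) (fun _ => rfl)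
    simp only [incl] at h
    exact h

end Constructor

section LInfinityStructure

variable {A : Type*} [CommRing A] [Algebra ℝ A] {n : ℕ} {η : Form A (n + 1)}

/-- The generalized Jacobi identity for at least three Hamiltonian forms: the terms `l₁ l_m` and
`l_{m-1} l₂` cancel by the second order formula for `d`. -/
lemma nestedBracket_add_eq_zero (hη : exteriorDeriv (n + 1) η = 0) {m : ℕ}
    {y : Fin (m + 3) → TotalObservables η} {j : Fin (m + 3) → ℕ}
    {α : Fin (m + 3) → MixedForm A} {v : Fin (m + 3) → Multivector A} {a : Fin (m + 3) → ℤ × ℤ}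
    (ha : ∀ t, a t = (0, (j t : ℤ)))
    (hy : ∀ t, y t = homogeneous η (0, (j t : ℤ)) (α t))
    (hα : ∀ t, α t ∈ observables n η (0, (j t : ℤ)))
    (hv : ∀ t, IsHamiltonianFor (ofForm η) (j t + 1) (α t) (v t)) :
    ∑ σ : Equiv.Perm (Fin (m + 3)) with IsUnshuffle 2 σ,
      (Equiv.Perm.sign σ * koszulSign (fun t => totalDegree (a t)) σ) •
        nestedBracket y ⟨1, by omega⟩ σ + nestedBracket y (Fin.last (m + 2)) 1 = 0 := by
  have hd := fun t => d_contract_of_isHamiltonianFor (hv t)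
  rw [nestedBracket_last hη hy hα hv (by omega) (by simp),
    d_contract_prod_unshuffle (m := m + 1) (p := fun t => ((j t + 1 : ℕ) : ZMod 2)) (d_ofForm hη)
      (fun t => (hv t).1) hd (fun t => rfl), map_sum, Finset.smul_sum, ← Finset.sum_add_distrib]
  refine Finset.sum_eq_zero fun σ _ => ?_
  rw [nestedBracket_inner_two hη hy hα hv, intUnits_smul_eq, sign_mul_koszulSign j ha, smul_neg,
    smul_smul, ← sgn_add, map_smul, smul_smul, ← sgn_add, neg_add_eq_zero]
  rw [show (((m + 3 : ℕ) : ℤ) - 3) = m by push_cast; ring]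
  congr 2
  grind

lemma units_smul_eq_zero (u : ℤˣ) {z : TotalObservables η} (h : z = 0) : u • z = 0 := by
  rw [h, smul_zero]

/-- The generalized Jacobi identities for the brackets on observables. -/
lemma observableBracket_jacobi (hη : exteriorDeriv (n + 1) η = 0) {m : ℕ}
    {a : Fin m → ℤ × ℤ} {x : ∀ t, observables n η (a t)} {y : Fin m → TotalObservables η}
    (hy : ∀ t, y t = incl (fun a => observables n η a) (a t) (x t)) :
    ∑ i : Fin m, ∑ σ : Equiv.Perm (Fin m) with IsUnshuffle (i + 1) σ,
      (Equiv.Perm.sign σ * koszulSign (fun t => totalDegree (a t)) σ *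
          (-1) ^ (((i : ℕ) + 1) * (m - i - 1))) • nestedBracket y i σ = 0 := by
  -- Some argument is annihilated by all higher brackets: every term vanishes.
  by_cases h : ∃ t, ∀ s, slot η s (y t) = 0
  · obtain ⟨t, ht⟩ := h
    refine Finset.sum_eq_zero fun i _ => Finset.sum_eq_zero fun σ _ => ?_
    rcases Nat.eq_zero_or_pos i with hi | hi
    · exact units_smul_eq_zero _ (nestedBracket_of_eq_zero hy hi _)
    · exact units_smul_eq_zero _ (nestedBracket_of_slot_eq_zero ht hi _)
  choose j α v ha hx hα hv using fun t =>
    (slot_eq_zero_or_exists_isHamiltonianFor (a t) (x t)).resolve_left fun h' =>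
      h ⟨t, by rwa [hy]⟩
  replace hx := fun t => (hy t).trans (hx t)
  rcases (show m ≤ 2 ∨ ∃ k, m = k + 3 by
    rcases Nat.lt_or_ge m 3 with h | h
    exacts [Or.inl (by omega), Or.inr ⟨m - 3, by omega⟩]) with hm | ⟨m, rfl⟩
  · refine Finset.sum_eq_zero fun i _ => Finset.sum_eq_zero fun σ _ => ?_
    rcases Nat.eq_zero_or_pos i with hi | hi
    · exact units_smul_eq_zero _ (nestedBracket_of_eq_zero hy hi _)
    · exact units_smul_eq_zero _ (nestedBracket_two_eq_zero hx hα hv (by omega) (by omega) _)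
  · -- Only the terms `l_{m+2} l₂` and `l₁ l_{m+3}` survive, with indices `1` and `m + 2`.
    have hne : (⟨1, by omega⟩ : Fin (m + 3)) ≠ Fin.last (m + 2) := by
      intro h'
      have := congrArg Fin.val h'
      simp at this
    rw [Fintype.sum_eq_add _ _ hne]
    · have hlast : (Finset.univ.filter fun σ : Equiv.Perm (Fin (m + 3)) =>
          IsUnshuffle ((Fin.last (m + 2) : Fin (m + 3)) + 1) σ) = {1} := by
        ext σ
        simp only [Finset.mem_filter, Finset.mem_univ, true_and, Finset.mem_singleton]
        exact isUnshuffle_self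
      rw [hlast, Finset.sum_singleton, koszulSign_one]
      have h1 : (-1 : ℤˣ) ^ ((((⟨1, by omega⟩ : Fin (m + 3)) : ℕ) + 1) *
          (m + 3 - ((⟨1, by omega⟩ : Fin (m + 3)) : ℕ) - 1)) = 1 := by
        rw [pow_mul]
        simp
      have h2 : (-1 : ℤˣ) ^ (((Fin.last (m + 2) : ℕ) + 1) *
          (m + 3 - (Fin.last (m + 2) : ℕ) - 1)) = 1 := by
        rw [Fin.val_last, show m + 3 - (m + 2) - 1 = 0 by omega, mul_zero, pow_zero]
      rw [h1, h2]
      simp only [mul_one, Equiv.Perm.sign_one, one_smul]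
      exact nestedBracket_add_eq_zero hη ha hx hα hv
    · rintro i ⟨h1, h2⟩
      refine Finset.sum_eq_zero fun σ _ => ?_
      rcases Nat.eq_zero_or_pos i with hi | hi
      · exact units_smul_eq_zero _ (nestedBracket_of_eq_zero hy hi _)
      · have h3 : (i : ℕ) ≠ 1 := fun h => h1 (Fin.ext h)
        have h4 : (i : ℕ) ≠ m + 2 := fun h => h2 (Fin.ext h)
        exact units_smul_eq_zero _
          (nestedBracket_of_two_le (i := i) hx hα hv (by omega) (by omega) _)

/-- The bracket `l_k` has bidegree `(k - 2, 0)`. -/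
lemma observableBracket_mem_range {k : ℕ} (hk : 1 ≤ k) {a : Fin k → ℤ × ℤ}
    {x : ∀ t, observables n η (a t)} {y : Fin k → TotalObservables η}
    (hy : ∀ t, y t = incl (fun a => observables n η a) (a t) (x t)) :
    observableBracket η k y ∈ LinearMap.range
      (incl (fun a => observables n η a) ((k : ℤ) - 2 + ∑ t, (a t).1, ∑ t, (a t).2)) := by
  rcases hk.eq_or_lt with rfl | hk
  · rw [observableBracket_one rfl, hy, ← homogeneous_coe, Fin.mk_zero]
    by_cases h : 1 ≤ (a 0).1
    · rw [unaryBracket_homogeneous h (x 0).2]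
      refine homogeneous_mem_range ?_ _
      simp
      ring
    · rw [unaryBracket_homogeneous_of_lt (not_le.1 h)]
      exact zero_mem _
  by_cases h : ∃ t, ∀ s, slot η s (y t) = 0
  · obtain ⟨t, ht⟩ := h
    rw [observableBracket_eq_zero hk t (ht _)]
    exact zero_mem _
  · choose j α v ha hx hα hv using fun t =>
      (slot_eq_zero_or_exists_isHamiltonianFor (a t) (x t)).resolve_left fun h' =>
        h ⟨t, by rwa [hy]⟩
    rw [observableBracket_homogeneous hk (fun t => (hy t).trans (hx t)) hα hv]
    refine Submodule.smul_mem _ _ (homogeneous_mem_range ?_ _)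
    simp [ha]

/-- The graded `L∞`-algebra of observables of a closed form. -/
def observableLInfinity (hη : exteriorDeriv (n + 1) η = 0) :
    GradedLInfinityAlgebra (fun a => observables n η a) :=
  linfinityOfIncl (observableBracket η)
    (fun _ hk _ _ _ hy => observableBracket_mem_range hk hy)
    (fun _ hk _ _ _ hy σ => observableBracket_comp_perm hk hy σ)
    (fun _ _ _ _ hy => observableBracket_jacobi hη hy)

/-- The value of the higher brackets on Hamiltonian forms. -/
lemma observableBracket_apply (hη : exteriorDeriv (n + 1) η = 0) {k : ℕ} (hk : 2 ≤ k)
    {j : Fin k → ℕ} {J : ℤ} (hJ : ∑ t, (j t : ℤ) = J)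
    {α : ∀ t, observables n η (0, (j t : ℤ))} {v : Fin k → Multivector A}
    (hv : ∀ t, IsHamiltonianFor (ofForm η) (j t + 1) (α t) (v t)) :
    (observableBracket η k (fun t => incl (fun a => observables n η a) _ (α t))
      ((k : ℤ) - 2, J) : MixedForm A) =
      (-1 : ℝ) ^ (∑ t : Fin k, (t : ℕ) * (j t + 1)) • contract (List.ofFn v).prod (ofForm η) := by
  subst hJ
  have hmem := contract_prod_mem_observables hη hk (fun t => (hv t).1)
    (fun t => d_contract_of_isHamiltonianFor (hv t))
  rw [observableBracket_homogeneous hk (α := fun t => (α t : MixedForm A))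
    (fun t => (homogeneous_coe (α t)).symm) (fun t => (α t).2) hv, ← sgn_natCast, ← map_smul,
    ← Nat.cast_sum, homogeneous_apply (Submodule.smul_mem _ _ hmem)]
  congr 2
  push_cast
  rfl

lemma observableBracket_one_apply {i j : ℕ} (α : observables n η ((i : ℤ) + 1, (j : ℤ))) :
    (observableBracket η 1 (fun _ => incl (fun a => observables n η a) _ α)
      ((i : ℤ), (j : ℤ)) : MixedForm A) = d _ (α : MixedForm _) := by
  have hmem := d_mem_observables (a := ((i : ℤ) + 1, (j : ℤ))) (by simp) α.2
  rw [observableBracket_one rfl, ← homogeneous_coe, unaryBracket_homogeneous (by simp) α.2]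
  simp only [add_sub_cancel_right] at hmem ⊢
  exact homogeneous_apply hmem

lemma observableBracket_one_eq_zero {j : ℕ} (α : observables n η (0, (j : ℤ))) :
    observableBracket η 1 (fun _ => incl (fun a => observables n η a) _ α) = 0 := by
  rw [observableBracket_one rfl, ← homogeneous_coe, unaryBracket_homogeneous_of_lt (by simp)]

lemma observableBracket_eq_zero_of_pos {k : ℕ} (hk : 2 ≤ k) {a : Fin k → ℤ × ℤ}
    (α : ∀ t, observables n η (a t)) (t : Fin k) (ht : 0 < (a t).1) :
    observableBracket η k (fun t => incl (fun a => observables n η a) _ (α t)) = 0 := by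
  refine observableBracket_eq_zero hk t ?_
  rw [← homogeneous_coe]
  exact slot_homogeneous_of_not (fun h => ht.ne' h.1) _ _

/-- The sign of Rogers' bracket comes from the position signs at `j = 0`, one sign for each of the
`k` arguments replaced by its negative, and one for the result. -/
lemma rogersSign_eq (k : ℕ) :
    rogersSign k = -((-1) ^ (∑ t : Fin k, (t : ℕ) * (0 + 1)) * (-1) ^ k) := by
  induction k using Nat.twoStepInduction with
  | zero => simp [rogersSign]
  | one => simp [rogersSign]
  | more k ih _ =>
    have h : rogersSign (k + 2) = -rogersSign k := by
      unfold rogersSign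
      by_cases hk : Even k
      · rw [if_pos hk, if_pos (by simpa [parity_simps] using hk), Nat.add_div_right _ two_pos,
          pow_succ _ (k / 2 + 1)]
        simp
      · have : (k + 2 - 1) / 2 = (k - 1) / 2 + 1 := by
          have : k ≠ 0 := fun h => hk (h ▸ Even.zero)
          omega
        rw [if_neg hk, if_neg (by simpa [parity_simps] using hk), this, pow_succ]
        simp
    rw [h, ih, Fin.sum_univ_castSucc, Fin.sum_univ_castSucc]
    simp only [Fin.val_castSucc, Fin.val_last, pow_add, zero_add, mul_one, pow_one]
    have hk : (-1 : ℝ) ^ k * (-1) ^ k = 1 := by rw [← mul_pow]; simp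
    linear_combination (-((-1 : ℝ) ^ (∑ t : Fin k, (t : ℕ)) * (-1) ^ k)) * hk

/-- After the change of sign `α ↦ -α`, the bracket on `L_{0,0}` is Rogers' bracket. -/
lemma neg_observableBracket_apply (hη : exteriorDeriv (n + 1) η = 0) {k : ℕ} (hk : 2 ≤ k)
    (α : Fin k → observables n η (0, 0)) (X : Fin k → VField A)
    (hX : ∀ t, d _ (-(α t : MixedForm A)) = -contract (ExteriorAlgebra.ι _ (X t)) (ofForm η)) :
    -(observableBracket η k (fun t => incl (fun a => observables n η a) _ (α t))
      ((k : ℤ) - 2, 0) : MixedForm A) =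
      rogersSign k • contract (List.ofFn fun t => ExteriorAlgebra.ι _ (X t)).prod (ofForm η) := by
  have hv : ∀ t, IsHamiltonianFor (ofForm η) (0 + 1) (α t : MixedForm A)
      ((-1 : ℝ) • ExteriorAlgebra.ι A (X t)) := fun t =>
    ⟨real_smul_mem_exteriorPower _ (ι_mem_exteriorPower _), by
      have h := hX t
      rw [map_neg, neg_inj] at h
      rw [h, contract_smul_left]
      module⟩
  have h := observableBracket_apply hη hk (j := fun _ => 0) (J := 0) (by simp) (α := α) hv
  have hprod : (List.ofFn fun t => (-1 : ℝ) • ExteriorAlgebra.ι A (X t)).prod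
      = (-1 : ℝ) ^ k • (List.ofFn fun t => ExteriorAlgebra.ι A (X t)).prod := by
    have := (MultilinearMap.mkPiAlgebraFin ℝ k (Multivector A)).map_smul_univ
      (fun _ => (-1 : ℝ)) (fun t => ExteriorAlgebra.ι A (X t))
    simpa using this
  rw [hprod, contract_smul_left, smul_smul] at h
  rw [rogersSign_eq]
  exact (congrArg Neg.neg h).trans (by module)

end LInfinityStructure

section Nondegenerate

variable {m : ℕ} {M : Type*} [TopologicalSpace M] [ChartedSpace (EuclideanSpace ℝ (Fin m)) M]

/-- Existence is the definition of a Hamiltonian form. Nondegeneracy at every point gives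
uniqueness: a derivation is determined by its values at the points of `M`. -/
lemma existsUnique_hamiltonianField {n : ℕ} {η : Form (SmoothFun (m := m) M) (n + 1)}
    (hη : IsNPlectic η) (α : observables n η (0, 0)) :
    ∃! X : VField (SmoothFun (m := m) M),
      d _ (α : MixedForm _) = -contract (ExteriorAlgebra.ι _ X) (ofForm η) := by
  obtain ⟨v, hv, hα⟩ := (mem_observables_zero (j := 0).1 α.2).2
  obtain ⟨X, rfl⟩ := exists_ι_of_mem_exteriorPower_one hv
  refine ⟨X, hα, fun Y hY => ?_⟩
  have h := neg_injective (hY.symm.trans hα)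
  rw [contract_ι, contract_ι] at h
  -- Both fields contract with `η` in the same way, so their difference is in the kernel of `η`.
  have h' : contractField (Y - X) (ofForm η) = 0 := by
    rw [map_sub, LinearMap.sub_apply, h, sub_self]
  rw [← sub_eq_zero]
  ext f x
  have hx := hη.nondegenerate x (Y - X) fun Z => by
    have h2 := congrArg (fun β : MixedForm (SmoothFun (m := m) M) => β n Z x) h'
    simpa [contractField_apply, ofForm, -map_sub] using h2
  exact congrArg (fun D => D f) hx

end Nondegenerate

end NPlectic

end

open NPlectic in
theorem theorem3p2 {m : ℕ} {M : Type*} [TopologicalSpace M] [T2Space M]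
    [SecondCountableTopology M] [ChartedSpace (EuclideanSpace ℝ (Fin m)) M]
    [IsManifold (𝓡 m) ∞ M]
    (n : ℕ) (η : Form (SmoothFun (m := m) M) (n + 1)) (hη : IsNPlectic η) :
    ∃ S : GradedLInfinityAlgebra (fun a => observables n η a),
      -- `l₁ = d` on `L_{i,j}` with `i ≥ 1`, and `l₁ = 0` on `L_{0,j}`
      (∀ (i j : ℕ) (α : observables n η ((i : ℤ) + 1, (j : ℤ))),
        (S.bracket 1 (fun _ => DirectSum.lof ℝ _ (fun a => observables n η a) _ α)
          ((i : ℤ), (j : ℤ)) : MixedForm (SmoothFun (m := m) M)) = d _ (α : MixedForm _)) ∧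
      (∀ (j : ℕ) (α : observables n η (0, (j : ℤ))),
        S.bracket 1 (fun _ => DirectSum.lof ℝ _ (fun a => observables n η a) _ α) = 0) ∧
      -- `l_k`, `k ≥ 2`, on `L_{0,•}`, for any Hamiltonian multivector fields of the arguments
      (∀ (k : ℕ), 2 ≤ k → ∀ (j : Fin k → ℕ) (α : ∀ t, observables n η (0, (j t : ℤ)))
        (v : Fin k → Multivector (SmoothFun (m := m) M)),
        (∀ t, IsHamiltonianFor (ofForm η) (j t + 1) (α t) (v t)) →
          (S.bracket k (fun t => DirectSum.lof ℝ _ (fun a => observables n η a) _ (α t))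
            ((k : ℤ) - 2, ∑ t, (j t : ℤ)) : MixedForm (SmoothFun (m := m) M)) =
          (-1 : ℝ) ^ (∑ t : Fin k, (t : ℕ) * (j t + 1)) •
            contract (List.ofFn v).prod (ofForm η)) ∧
      -- `l_k`, `k ≥ 2`, vanishes if some argument has positive first degree
      (∀ (k : ℕ), 2 ≤ k → ∀ (a : Fin k → ℤ × ℤ) (α : ∀ t, observables n η (a t)),
        (∃ t, 0 < (a t).1) →
          S.bracket k (fun t => DirectSum.lof ℝ _ (fun a => observables n η a) _ (α t)) = 0) ∧
      -- on `L_{•,0}` this is Rogers' `L∞`-algebra, after the change of sign `α ↦ -α`: each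
      -- Hamiltonian `(n-1)`-form has a unique Hamiltonian vector field, and
      -- `-l_k (α₁, …, α_k)` is Rogers' bracket of `-α₁, …, -α_k`
      (∀ α : observables n η (0, 0), ∃! X : VField (SmoothFun (m := m) M),
        d _ (α : MixedForm _) = -contract (ExteriorAlgebra.ι _ X) (ofForm η)) ∧
      (∀ (k : ℕ), 2 ≤ k → ∀ (α : Fin k → observables n η (0, 0))
        (X : Fin k → VField (SmoothFun (m := m) M)),
        (∀ t, d _ (-(α t : MixedForm _)) = -contract (ExteriorAlgebra.ι _ (X t)) (ofForm η)) →
          -(S.bracket k (fun t => DirectSum.lof ℝ _ (fun a => observables n η a) _ (α t))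
            ((k : ℤ) - 2, 0) : MixedForm (SmoothFun (m := m) M)) =
          rogersSign k •
            contract (List.ofFn fun t => ExteriorAlgebra.ι _ (X t)).prod (ofForm η)) := by
  refine ⟨observableLInfinity hη.closed, ?_, ?_, ?_, ?_, ?_, ?_⟩
  · intro i j α
    exact observableBracket_one_apply α
  · intro j α
    exact observableBracket_one_eq_zero α
  · intro k hk j α v hv
    exact observableBracket_apply hη.closed hk rfl hv
  · rintro k hk a α ⟨t, ht⟩
    exact observableBracket_eq_zero_of_pos hk α t ht
  · intro α
    exact existsUnique_hamiltonianField hη α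
  · intro k hk α X hX
    exact neg_observableBracket_apply hη.closed hk α X hX
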